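/- **Corollary (Weak pseudo-randomness).** Fix graphs $G_1,\dots,G_s$ ($s\ge 1$), where $G_i$ has vertex set $V_i=\{1,\dots,|V_i|\}$ and edge set $E_i$ and $G_1$ is a single edge on two vertices, and constants $\beta_1\in\mathbb R$ and $\beta_2,\dots,\beta_s\ge 0$. For a graph $X$ on the vertex set $[n]$ let $N_G(X)$ be the number of labelled (not necessarily induced) copies of $G$ in $X$, i.e. of tuples $(v_i)$ of distinct vertices of $X$, indexed by the vertices of $G$, such that $v_iv_j$ is an edge of $X$ whenever $ij$ is an edge of $G$. The exponential random graph on $[n]$ is the random graph with law $$\mathbb P_n(X)=\frac1{Z_n(\beta)}\exp\Big(\sum_{i=1}^s\beta_i\frac{N_{G_i}(X)}{n^{|V_i|-2}}\Big).$$ Let $\Psi(p)=\sum_{i=1}^s 2\beta_i|E_i|p^{|E_i|-1}$ and $\varphi(p)=e^{\Psi(p)}/(1+e^{\Psi(p)})$. Assume that $\beta$ is in the high temperature phase: $\varphi(p)=p$ has a unique solution $p^*$ in $[0,1]$, and $\varphi'(p^*)<1$. Then, with probability $1-o(1)$ as $n\to\infty$, the exponential random graph on $[n]$ is weakly pseudo-random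 with density $p^*$. That is, there are sets $S_n$ of graphs on $[n]$ with $\mathbb P_n(S_n)\to1$ such that every sequence of graphs $X_n$ on $[n]$ with $X_n\in S_n$ for all sufficiently large $n$ satisfies all of the following with $p=p^*$: 1. for every fixed $l\ge4$ and every graph $G$ on $l$ vertices, the number of labelled induced copies of $G$ in $X_n$ is $(1+o(1))\,n^l p^{|E(G)|}(1-p)^{\binom l2-|E(G)|}$; 2. $X_n$ has at least $\frac{n^2p}2+o(n^2)$ edges, and the eigenvalues of its adjacency matrix, ordered so that $|\lambda_1|\ge|\lambda_2|\ge\dots\ge|\lambda_n|$, satisfy $\lambda_1=(1+o(1))np$ and $\lambda_2=o(n)$; 3. for every $U\subseteq[n]$ the number of edges of $X_n$ inside $U$ is $\frac p2|U|^2+o(n^2)$, uniformly in $U$; 4. $X_n$ has $\frac{n^2p}2+o(n^2)$ edges, and for every fixed even $l\ge4$ the number of labelled copies of the cycle $C_l$ satisfies $N_{C_l}(X_n)\le (np)^l+o(n^l)$. -/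

import Mathlib

open Filter Asymptotics

noncomputable section

namespace ERG

/-- The number `N_G(X)` of labelled (not necessarily induced) copies of `G` in `X`, that is, of
tuples of distinct vertices `(v_i)` of `X` such that every edge `ij` of `G` gives an edge `v_i v_j`
of `X`. -/
def copyCount {m n : ℕ} (G : SimpleGraph (Fin m)) (X : SimpleGraph (Fin n)) : ℕ :=
  X.labelledCopyCount G

/-- The number `N*_G(X)` of labelled induced copies of `G` in `X`. -/
def inducedCopyCount {m n : ℕ} (G : SimpleGraph (Fin m)) (X : SimpleGraph (Fin n)) : ℕ :=
  Nat.card (G ↪g X)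

/-- The number of edges. -/
def edgeCount {V : Type*} (X : SimpleGraph V) : ℕ := Nat.card X.edgeSet

/-- The data of an exponential random graph model: finitely many fixed labelled graphs
`G 0, …, G s`, the first of which is a single edge, and weights `β 0, …, β s`, where only the
weight `β 0` of the edge may be negative. -/
structure Model where
  s : ℕ
  V : Fin (s + 1) → ℕ
  G : (i : Fin (s + 1)) → SimpleGraph (Fin (V i))
  β : Fin (s + 1) → ℝ
  edge_first : (⟨V 0, G 0⟩ : Σ m : ℕ, SimpleGraph (Fin m)) = ⟨2, ⊤⟩
  β_nonneg : ∀ i, i ≠ 0 → 0 ≤ β i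

namespace Model

variable (M : Model)

/-- The Hamiltonian `H(X) = ∑ i, β i * N_{G i}(X) / n ^ (|V i| - 2)` on graphs with vertex set
`Fin n`; the exponent is an integer. -/
def hamiltonian {n : ℕ} (X : SimpleGraph (Fin n)) : ℝ :=
  ∑ i, M.β i * ((copyCount (M.G i) X : ℝ) / (n : ℝ) ^ ((M.V i : ℤ) - 2))

/-- The partition function `Z_n(β)`. -/
def partitionFunction (n : ℕ) : ℝ :=
  ∑ X : SimpleGraph (Fin n), Real.exp (M.hamiltonian X)

/-- The Gibbs weight `p_n(X) = exp (H(X)) / Z_n(β)`. -/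
def gibbs {n : ℕ} (X : SimpleGraph (Fin n)) : ℝ :=
  Real.exp (M.hamiltonian X) / M.partitionFunction n

open Classical in
/-- The probability of the event `S` for the exponential random graph on `n` vertices. -/
def prob {n : ℕ} (S : Set (SimpleGraph (Fin n))) : ℝ :=
  ∑ X : SimpleGraph (Fin n), if X ∈ S then M.gibbs X else 0

/-- `Ψ_β(p) = ∑ i, 2 β i |E i| p ^ (|E i| - 1)` (a term with `|E i| = 0` vanishes). -/
def psi (p : ℝ) : ℝ :=
  ∑ i, 2 * M.β i * (edgeCount (M.G i) : ℝ) * p ^ (edgeCount (M.G i) - 1)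

/-- `φ_β(p) = exp (Ψ_β(p)) / (1 + exp (Ψ_β(p)))`. -/
def phi (p : ℝ) : ℝ := Real.exp (M.psi p) / (1 + Real.exp (M.psi p))

/-- The model is in the high temperature phase, and `p` is its `p*`: the unique fixed point of
`φ_β` in `[0, 1]` is `p`, and `φ_β'(p) < 1`. -/
structure HighTemperature (p : ℝ) : Prop where
  mem_Icc : p ∈ Set.Icc (0 : ℝ) 1
  fixed : M.phi p = p
  unique : ∀ q ∈ Set.Icc (0 : ℝ) 1, M.phi q = q → q = p
  deriv_lt_one : deriv M.phi p < 1

end Model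

open Classical in
/-- The adjacency eigenvalues of `X` (with multiplicity) ordered so that
`|λ 0| ≥ |λ 1| ≥ … ≥ |λ (n - 1)|`; the index starts at `0`, and `λ k = 0` for `k ≥ n`. -/
def adjEigenvalue {n : ℕ} (X : SimpleGraph (Fin n)) (k : ℕ) : ℝ :=
  let ev : Fin n → ℝ := (X.isHermitian_adjMatrix (R := ℝ)).eigenvalues
  if h : k < n then ev (Tuple.sort (fun i => -|ev i|) ⟨k, h⟩) else 0

/-- A sequence of graphs `X n` on `n` vertices is weakly pseudo-random with density `p`. -/
structure WeaklyPseudoRandom (p : ℝ) (X : (n : ℕ) → SimpleGraph (Fin n)) : Prop where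
  /-- For every `l ≥ 4` and every graph `G` on `l` vertices,
  `N*_G(X n) = (1 + o(1)) n ^ l p ^ |E(G)| (1 - p) ^ (l.choose 2 - |E(G)|)`. -/
  induced_counts : ∀ l : ℕ, 4 ≤ l → ∀ G : SimpleGraph (Fin l),
    (fun n : ℕ => (inducedCopyCount G (X n) : ℝ)) ~[atTop]
      fun n : ℕ => (n : ℝ) ^ l * p ^ edgeCount G * (1 - p) ^ (l.choose 2 - edgeCount G)
  /-- `N_edges(X n) ≥ n² p / 2 + o(n²)`, `λ₁ = (1 + o(1)) n p`, `λ₂ = o(n)`. -/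
  edges_ge : ∃ r : ℕ → ℝ, r =o[atTop] (fun n : ℕ => (n : ℝ) ^ 2) ∧
    ∀ n : ℕ, (n : ℝ) ^ 2 * p / 2 + r n ≤ (edgeCount (X n) : ℝ)
  first_eigenvalue : (fun n : ℕ => adjEigenvalue (X n) 0) ~[atTop] fun n : ℕ => (n : ℝ) * p
  second_eigenvalue : (fun n : ℕ => adjEigenvalue (X n) 1) =o[atTop] fun n : ℕ => (n : ℝ)
  /-- Every vertex set `U` spans `(p / 2) |U|² + o(n²)` edges, uniformly in `U`. -/
  induced_edges : ∃ r : ℕ → ℝ, r =o[atTop] (fun n : ℕ => (n : ℝ) ^ 2) ∧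
    ∀ (n : ℕ) (U : Finset (Fin n)),
      |(edgeCount ((X n).induce (U : Set (Fin n))) : ℝ) - p / 2 * (U.card : ℝ) ^ 2| ≤ r n
  /-- `N_edges(X n) = n² p / 2 + o(n²)`, and `N_{C_l}(X n) ≤ (n p) ^ l + o(n ^ l)` for every even
  `l ≥ 4`. -/
  edges_eq : (fun n : ℕ => (edgeCount (X n) : ℝ) - (n : ℝ) ^ 2 * p / 2)
    =o[atTop] fun n : ℕ => (n : ℝ) ^ 2
  cycle_counts : ∀ l : ℕ, 4 ≤ l → Even l →
    ∃ r : ℕ → ℝ, r =o[atTop] (fun n : ℕ => (n : ℝ) ^ l) ∧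
      ∀ n : ℕ, (copyCount (SimpleGraph.cycleGraph l) (X n) : ℝ) ≤ ((n : ℝ) * p) ^ l + r n

end ERG

end

/-! Resampling one edge `e` shows that, given all other edges, `e` is present with probability
`condProb`, the logistic function of the energy gap. For a copy count the gap is a normalized
average, over the placements of the graph through `e`, of indicators that the remaining edges are
present.

The probabilistic half is a two-sided bootstrap. `Dominated d q` says that, up to o(1), the edges
are no likelier (`d = 1`) or no less likely (`d = -1`) than independent edges of probability `q`,
tested on boundedly many disjoint edge sets of bounded size. It makes high moments of the averages
above small enough for Markov's inequality, since random placements are almost always disjoint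
(`Dominated.exists_prob_avgInd_le`). So the energy gap is at most, respectively at least, `psi q` up
to a small error with high probability, and therefore `Dominated d (phi q)` holds (`Dominated.phi`).
The bounds `Dominated 1 1` and `Dominated (-1) 0` are trivial. As `phi` is increasing on nonnegative
reals, its iterates from 1 and from 0 are monotone, and they converge to fixed points, both equal to
`p` by uniqueness (`HighTemperature.dominated`).

Both directions at `p` give P(F ⊆ E(X)) → p^|F| uniformly over edge sets of fixed size. As the
square of a homomorphism density is again one, a second moment argument makes every homomorphism
density concentrate at its value for density `p`; a weighted sum over the countably many patterns
gives one sequence of events (`HighTemperature.exists_typical`).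

The rest is deterministic, in the manner of Chung, Graham and Wilson. Induced and cycle counts are
read off the densities. The closed 4-walk sum of the adjacency matrix bounds the sum of the fourth
powers of the two leading eigenvalues, and that of the adjacency matrix minus `p` bounds the
discrepancy of every vertex set. -/

open Filter Asymptotics

noncomputable section

namespace ERG

/-! ### Expectation under the Gibbs measure -/

namespace Model

variable (M : Model) {n : ℕ}

/-- The expectation of `f` under the exponential random graph. -/
def expect (f : SimpleGraph (Fin n) → ℝ) : ℝ := ∑ X, M.gibbs X * f X

lemma partitionFunction_pos (n : ℕ) : 0 < M.partitionFunction n :=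
  Finset.sum_pos (fun _ _ => Real.exp_pos _) Finset.univ_nonempty

lemma gibbs_pos (X : SimpleGraph (Fin n)) : 0 < M.gibbs X :=
  div_pos (Real.exp_pos _) (M.partitionFunction_pos n)

lemma sum_gibbs : ∑ X : SimpleGraph (Fin n), M.gibbs X = 1 := by
  simp only [gibbs, ← Finset.sum_div]
  exact div_self (M.partitionFunction_pos n).ne'

lemma expect_mono {f g : SimpleGraph (Fin n) → ℝ} (h : ∀ X, f X ≤ g X) :
    M.expect f ≤ M.expect g :=
  Finset.sum_le_sum fun X _ => mul_le_mul_of_nonneg_left (h X) (M.gibbs_pos X).le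

lemma expect_nonneg {f : SimpleGraph (Fin n) → ℝ} (h : ∀ X, 0 ≤ f X) : 0 ≤ M.expect f :=
  Finset.sum_nonneg fun X _ => mul_nonneg (M.gibbs_pos X).le (h X)

lemma expect_const (c : ℝ) : M.expect (fun _ : SimpleGraph (Fin n) => c) = c := by
  simp [expect, ← Finset.sum_mul, sum_gibbs]

lemma expect_add (f g : SimpleGraph (Fin n) → ℝ) :
    M.expect (fun X => f X + g X) = M.expect f + M.expect g := by
  simp [expect, mul_add, Finset.sum_add_distrib]

lemma expect_sub (f g : SimpleGraph (Fin n) → ℝ) :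
    M.expect (fun X => f X - g X) = M.expect f - M.expect g := by
  simp [expect, mul_sub, Finset.sum_sub_distrib]

lemma expect_const_mul (c : ℝ) (f : SimpleGraph (Fin n) → ℝ) :
    M.expect (fun X => c * f X) = c * M.expect f := by
  simp only [expect, Finset.mul_sum]
  exact Finset.sum_congr rfl fun X _ => by ring

lemma expect_mul_const (c : ℝ) (f : SimpleGraph (Fin n) → ℝ) :
    M.expect (fun X => f X * c) = M.expect f * c := by
  simp only [mul_comm _ c, expect_const_mul]

lemma expect_sum {ι : Type*} (s : Finset ι) (f : ι → SimpleGraph (Fin n) → ℝ) :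
    M.expect (fun X => ∑ i ∈ s, f i X) = ∑ i ∈ s, M.expect (f i) := by
  simp only [expect, Finset.mul_sum]
  exact Finset.sum_comm

lemma prob_eq_expect (S : Set (SimpleGraph (Fin n))) :
    M.prob S = M.expect (S.indicator fun _ => 1) := by
  classical
  simp [prob, expect, Set.indicator_apply]

lemma prob_nonneg (S : Set (SimpleGraph (Fin n))) : 0 ≤ M.prob S := by
  rw [prob_eq_expect]
  exact M.expect_nonneg fun X => Set.indicator_nonneg (fun _ _ => zero_le_one) X

lemma prob_compl (S : Set (SimpleGraph (Fin n))) : M.prob Sᶜ = 1 - M.prob S := by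
  rw [prob_eq_expect, prob_eq_expect]
  rw [eq_sub_iff_add_eq, ← expect_add]
  refine Eq.trans ?_ (M.expect_const (n := n) 1)
  congr 1
  ext X
  by_cases h : X ∈ S <;> simp [h]

lemma prob_mono {S T : Set (SimpleGraph (Fin n))} (h : S ⊆ T) : M.prob S ≤ M.prob T := by
  rw [prob_eq_expect, prob_eq_expect]
  exact M.expect_mono fun X =>
    Set.indicator_le_indicator_of_subset h (fun _ => zero_le_one) X

/-- Markov's inequality. -/
lemma mul_prob_le_expect {f : SimpleGraph (Fin n) → ℝ} (hf : ∀ X, 0 ≤ f X) (y : ℝ) :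
    y * M.prob {X | y < f X} ≤ M.expect f := by
  rw [prob_eq_expect, ← expect_const_mul]
  refine M.expect_mono fun X => ?_
  by_cases h : y < f X
  · simp [h, h.le]
  · simp [h, hf X]

lemma prob_iUnion_le {ι : Type*} [Fintype ι] (S : ι → Set (SimpleGraph (Fin n))) :
    M.prob (⋃ i, S i) ≤ ∑ i, M.prob (S i) := by
  simp only [prob_eq_expect, ← expect_sum]
  refine M.expect_mono fun X => ?_
  have h0 : ∀ i ∈ Finset.univ, 0 ≤ (S i).indicator (fun _ => (1 : ℝ)) X :=
    fun i _ => Set.indicator_nonneg (fun _ _ => zero_le_one) X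
  by_cases h : X ∈ ⋃ i, S i
  · obtain ⟨i, hi⟩ := Set.mem_iUnion.1 h
    calc _ = (S i).indicator (fun _ => (1 : ℝ)) X := by simp [h, hi]
      _ ≤ _ := Finset.single_le_sum h0 (Finset.mem_univ i)
  · rw [Set.indicator_of_notMem h]
    exact Finset.sum_nonneg h0

end Model

/-! ### Edge indicators and the conditional law of an edge -/

section Edges

variable {n : ℕ}

/-- The indicator of `e` being an edge of `X`. -/
def edgeInd (X : SimpleGraph (Fin n)) (e : Sym2 (Fin n)) : ℝ := X.edgeSet.indicator 1 e

/-- The indicator of all elements of `F` being edges of `X`. -/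
def edgesInd (F : Finset (Sym2 (Fin n))) (X : SimpleGraph (Fin n)) : ℝ := ∏ e ∈ F, edgeInd X e

lemma edgeInd_of_mem {X : SimpleGraph (Fin n)} {e : Sym2 (Fin n)} (h : e ∈ X.edgeSet) :
    edgeInd X e = 1 := by simp [edgeInd, h]

lemma edgeInd_of_notMem {X : SimpleGraph (Fin n)} {e : Sym2 (Fin n)} (h : e ∉ X.edgeSet) :
    edgeInd X e = 0 := by simp [edgeInd, h]

lemma edgeInd_nonneg (X : SimpleGraph (Fin n)) (e : Sym2 (Fin n)) : 0 ≤ edgeInd X e :=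
  Set.indicator_nonneg (fun _ _ => zero_le_one) e

lemma edgeInd_le_one (X : SimpleGraph (Fin n)) (e : Sym2 (Fin n)) : edgeInd X e ≤ 1 := by
  by_cases h : e ∈ X.edgeSet
  · exact (edgeInd_of_mem h).le
  · exact (edgeInd_of_notMem h).le.trans zero_le_one

lemma edgesInd_nonneg (F : Finset (Sym2 (Fin n))) (X : SimpleGraph (Fin n)) :
    0 ≤ edgesInd F X := Finset.prod_nonneg fun e _ => edgeInd_nonneg X e

lemma edgesInd_le_one (F : Finset (Sym2 (Fin n))) (X : SimpleGraph (Fin n)) :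
    edgesInd F X ≤ 1 :=
  Finset.prod_le_one (fun e _ => edgeInd_nonneg X e) fun e _ => edgeInd_le_one X e

lemma edgesInd_of_subset {F : Finset (Sym2 (Fin n))} {X : SimpleGraph (Fin n)}
    (h : (F : Set (Sym2 (Fin n))) ⊆ X.edgeSet) : edgesInd F X = 1 :=
  Finset.prod_eq_one fun _ he => edgeInd_of_mem (h he)

lemma edgesInd_of_not_subset {F : Finset (Sym2 (Fin n))} {X : SimpleGraph (Fin n)}
    (h : ¬ (F : Set (Sym2 (Fin n))) ⊆ X.edgeSet) : edgesInd F X = 0 := by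
  obtain ⟨e, he, heX⟩ := Set.not_subset.1 h
  exact Finset.prod_eq_zero he (edgeInd_of_notMem heX)

/-- `X` with the edge `e` added. -/
def addEdge (X : SimpleGraph (Fin n)) (e : Sym2 (Fin n)) : SimpleGraph (Fin n) :=
  X ⊔ SimpleGraph.fromEdgeSet {e}

/-- `X` with the edge `e` removed. -/
def removeEdge (X : SimpleGraph (Fin n)) (e : Sym2 (Fin n)) : SimpleGraph (Fin n) :=
  X \ SimpleGraph.fromEdgeSet {e}

lemma edgeSet_addEdge (X : SimpleGraph (Fin n)) {e : Sym2 (Fin n)} (he : ¬ e.IsDiag) :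
    (addEdge X e).edgeSet = insert e X.edgeSet := by
  rw [addEdge, SimpleGraph.edgeSet_sup, SimpleGraph.edgeSet_fromEdgeSet]
  ext f
  simp only [Set.mem_union, Set.mem_sdiff, Set.mem_singleton_iff, Set.mem_insert_iff,
    Sym2.mem_diagSet]
  grind

lemma edgeSet_removeEdge (X : SimpleGraph (Fin n)) {e : Sym2 (Fin n)} (he : ¬ e.IsDiag) :
    (removeEdge X e).edgeSet = X.edgeSet \ {e} := by
  rw [removeEdge, SimpleGraph.edgeSet_sdiff, SimpleGraph.edgeSet_fromEdgeSet]
  ext f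
  simp only [Set.mem_sdiff, Set.mem_singleton_iff, Sym2.mem_diagSet]
  grind

lemma edgeInd_addEdge_of_ne (X : SimpleGraph (Fin n)) {e f : Sym2 (Fin n)} (he : ¬ e.IsDiag)
    (h : f ≠ e) : edgeInd (addEdge X e) f = edgeInd X f := by
  classical
  simp [edgeInd, edgeSet_addEdge X he, Set.indicator_apply, h]

lemma edgeInd_removeEdge_of_ne (X : SimpleGraph (Fin n)) {e f : Sym2 (Fin n)} (he : ¬ e.IsDiag)
    (h : f ≠ e) : edgeInd (removeEdge X e) f = edgeInd X f := by
  classical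
  simp [edgeInd, edgeSet_removeEdge X he, Set.indicator_apply, h]

/-- The function `A` of a graph does not depend on whether `e` is an edge. -/
def IndepOfEdge (A : SimpleGraph (Fin n) → ℝ) (e : Sym2 (Fin n)) : Prop :=
  ∀ X, A (addEdge X e) = A (removeEdge X e)

lemma indepOfEdge_edgesInd {F : Finset (Sym2 (Fin n))} {e : Sym2 (Fin n)} (he : ¬ e.IsDiag)
    (h : e ∉ F) : IndepOfEdge (edgesInd F) e := fun X =>
  Finset.prod_congr rfl fun f hf => by
    have : f ≠ e := fun hfe => h (hfe ▸ hf)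
    rw [edgeInd_addEdge_of_ne X he this, edgeInd_removeEdge_of_ne X he this]

lemma IndepOfEdge.addEdge {A : SimpleGraph (Fin n) → ℝ} {e : Sym2 (Fin n)} (h : IndepOfEdge A e)
    (X : SimpleGraph (Fin n)) : A (addEdge X e) = A X := by
  by_cases hX : SimpleGraph.fromEdgeSet {e} ≤ X
  · rw [ERG.addEdge, sup_eq_left.2 hX]
  · have : removeEdge X e = X := by
      rw [removeEdge, sdiff_eq_left, ← SimpleGraph.disjoint_edgeSet, SimpleGraph.edgeSet_fromEdgeSet]
      rw [← SimpleGraph.edgeSet_subset_edgeSet, SimpleGraph.edgeSet_fromEdgeSet] at hX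
      rw [Set.disjoint_left]
      rintro f hf ⟨hfe, -⟩
      exact hX fun g hg => by
        have h1 : f = e := hfe
        have h2 : g = e := hg.1
        rwa [h2, ← h1]
    rw [h X, this]

lemma IndepOfEdge.removeEdge {A : SimpleGraph (Fin n) → ℝ} {e : Sym2 (Fin n)}
    (h : IndepOfEdge A e) (X : SimpleGraph (Fin n)) : A (removeEdge X e) = A X := by
  rw [← h X, h.addEdge]

end Edges

/-- Toggling `e`, that is `X ↦ symmDiff X D`, is an involution of the set of graphs, and `X` and its
toggle are the two graphs `addEdge X e` and `removeEdge X e` in some order. -/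
lemma sum_flip {n : ℕ} (e : Sym2 (Fin n)) (h : SimpleGraph (Fin n) → ℝ) :
    2 * ∑ X, h X = ∑ X, (h (addEdge X e) + h (removeEdge X e)) := by
  set D : SimpleGraph (Fin n) := SimpleGraph.fromEdgeSet {e}
  have hs : ∑ X, h (symmDiff X D) = ∑ X, h X :=
    Fintype.sum_bijective (fun X => symmDiff X D)
      (Function.Involutive.bijective fun X => symmDiff_symmDiff_cancel_right D X) _ _ fun _ => rfl
  rw [two_mul]
  nth_rewrite 2 [← hs]
  rw [← Finset.sum_add_distrib]
  refine Finset.sum_congr rfl fun X _ => ?_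
  by_cases hX : D ≤ X
  · rw [show addEdge X e = X from sup_eq_left.2 hX,
      show symmDiff X D = removeEdge X e from symmDiff_of_ge hX]
  · have hd : Disjoint X D := by
      rw [← SimpleGraph.disjoint_edgeSet, SimpleGraph.edgeSet_fromEdgeSet]
      rw [← SimpleGraph.edgeSet_subset_edgeSet, SimpleGraph.edgeSet_fromEdgeSet] at hX
      rw [Set.disjoint_left]
      rintro f hf ⟨hfe, -⟩
      exact hX fun g hg => by
        have h1 : f = e := hfe
        have h2 : g = e := hg.1
        rwa [h2, ← h1]
    rw [show removeEdge X e = X from sdiff_eq_left.2 hd,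
      show symmDiff X D = addEdge X e from hd.symmDiff_eq_sup, add_comm]

namespace Model

variable (M : Model) {n : ℕ}

/-- The change of the Hamiltonian when the edge `e` is added. -/
def energyGap (e : Sym2 (Fin n)) (X : SimpleGraph (Fin n)) : ℝ :=
  M.hamiltonian (addEdge X e) - M.hamiltonian (removeEdge X e)

/-- The conditional probability of the edge `e` given all other edges. -/
def condProb (e : Sym2 (Fin n)) (X : SimpleGraph (Fin n)) : ℝ :=
  Real.exp (M.energyGap e X) / (1 + Real.exp (M.energyGap e X))

lemma condProb_nonneg (e : Sym2 (Fin n)) (X : SimpleGraph (Fin n)) : 0 ≤ M.condProb e X := by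
  unfold condProb; positivity

lemma condProb_le_one (e : Sym2 (Fin n)) (X : SimpleGraph (Fin n)) : M.condProb e X ≤ 1 := by
  unfold condProb
  rw [div_le_one (by positivity)]
  linarith

lemma addEdge_addEdge (X : SimpleGraph (Fin n)) (e : Sym2 (Fin n)) :
    addEdge (addEdge X e) e = addEdge X e := by simp [addEdge]

lemma removeEdge_removeEdge (X : SimpleGraph (Fin n)) (e : Sym2 (Fin n)) :
    removeEdge (removeEdge X e) e = removeEdge X e := by simp [removeEdge]

lemma addEdge_removeEdge (X : SimpleGraph (Fin n)) (e : Sym2 (Fin n)) :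
    addEdge (removeEdge X e) e = addEdge X e := by simp [addEdge, removeEdge]

lemma removeEdge_addEdge (X : SimpleGraph (Fin n)) (e : Sym2 (Fin n)) :
    removeEdge (addEdge X e) e = removeEdge X e := by simp [addEdge, removeEdge]

lemma indepOfEdge_condProb (e : Sym2 (Fin n)) : IndepOfEdge (M.condProb e) e := fun X => by
  simp [condProb, energyGap, addEdge_addEdge, removeEdge_addEdge, addEdge_removeEdge,
    removeEdge_removeEdge]

/-- The resampling identity behind all probabilistic estimates: after pairing graphs by `sum_flip`,
the Gibbs weights with and without `e` have ratio `exp (energyGap)`, while `A` takes the same value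
on both. -/
lemma expect_mul_edgeInd {A : SimpleGraph (Fin n) → ℝ} {e : Sym2 (Fin n)} (he : ¬ e.IsDiag)
    (hA : IndepOfEdge A e) :
    M.expect (fun X => A X * edgeInd X e) = M.expect (fun X => A X * M.condProb e X) := by
  refine mul_left_cancel₀ (two_ne_zero' ℝ) ?_
  rw [expect, expect, sum_flip e, sum_flip e]
  refine Finset.sum_congr rfl fun X _ => ?_
  have h1 : edgeInd (addEdge X e) e = 1 := edgeInd_of_mem (by simp [edgeSet_addEdge X he])
  have h0 : edgeInd (removeEdge X e) e = 0 := edgeInd_of_notMem (by simp [edgeSet_removeEdge X he])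
  rw [h1, h0, hA.addEdge, hA.removeEdge, (M.indepOfEdge_condProb e).addEdge,
    (M.indepOfEdge_condProb e).removeEdge]
  simp only [gibbs, condProb, energyGap, Real.exp_sub]
  have hZ := (M.partitionFunction_pos n).ne'
  have := Real.exp_pos (M.hamiltonian (addEdge X e))
  have := Real.exp_pos (M.hamiltonian (removeEdge X e))
  field_simp
  ring

end Model

/-! ### One-sided comparison with independent edges -/

/-- The affine function `y ↦ y` for `d = 1` and `y ↦ 1 - y` for `d = -1`. -/
def side (d y : ℝ) : ℝ := (1 - d) / 2 + d * y

lemma side_nonneg {d y : ℝ} (hd : d = 1 ∨ d = -1) (h0 : 0 ≤ y) (h1 : y ≤ 1) : 0 ≤ side d y := by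
  rcases hd with rfl | rfl <;> norm_num [side] <;> linarith

lemma side_le_one {d y : ℝ} (hd : d = 1 ∨ d = -1) (h0 : 0 ≤ y) (h1 : y ≤ 1) : side d y ≤ 1 := by
  rcases hd with rfl | rfl <;> norm_num [side] <;> linarith

section Lists

variable {n : ℕ}

/-- The product of `side d (1[F ⊆ E(X)])` over the members `F` of a list. -/
def sideProd (d : ℝ) (L : List (Finset (Sym2 (Fin n)))) (X : SimpleGraph (Fin n)) : ℝ :=
  (L.map fun F => side d (edgesInd F X)).prod

lemma sideProd_cons (d : ℝ) (F : Finset (Sym2 (Fin n))) (L : List (Finset (Sym2 (Fin n))))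
    (X : SimpleGraph (Fin n)) :
    sideProd d (F :: L) X = side d (edgesInd F X) * sideProd d L X := by simp [sideProd]

lemma sideProd_nonneg {d : ℝ} (hd : d = 1 ∨ d = -1) (L : List (Finset (Sym2 (Fin n))))
    (X : SimpleGraph (Fin n)) : 0 ≤ sideProd d L X := by
  induction L with
  | nil => simp [sideProd]
  | cons F L ih =>
    rw [sideProd_cons]
    exact mul_nonneg (side_nonneg hd (edgesInd_nonneg F X) (edgesInd_le_one F X)) ih

lemma sideProd_le_one {d : ℝ} (hd : d = 1 ∨ d = -1) (L : List (Finset (Sym2 (Fin n))))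
    (X : SimpleGraph (Fin n)) : sideProd d L X ≤ 1 := by
  induction L with
  | nil => simp [sideProd]
  | cons F L ih =>
    rw [sideProd_cons]
    exact mul_le_one₀ (side_le_one hd (edgesInd_nonneg F X) (edgesInd_le_one F X))
      (sideProd_nonneg hd L X) ih

/-- A list of `N` pairwise disjoint sets of `m` possible edges. -/
structure IsEdgeFamily (m N : ℕ) (L : List (Finset (Sym2 (Fin n)))) : Prop where
  length_eq : L.length = N
  disjoint : L.Pairwise Disjoint
  card_eq : ∀ F ∈ L, F.card = m
  not_isDiag : ∀ F ∈ L, ∀ e ∈ F, ¬ e.IsDiag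

lemma IsEdgeFamily.tail {m N : ℕ} {F : Finset (Sym2 (Fin n))} {L : List (Finset (Sym2 (Fin n)))}
    (h : IsEdgeFamily m (N + 1) (F :: L)) : IsEdgeFamily m N L where
  length_eq := by simpa using h.length_eq
  disjoint := (List.pairwise_cons.1 h.disjoint).2
  card_eq G hG := h.card_eq G (List.mem_cons_of_mem _ hG)
  not_isDiag G hG := h.not_isDiag G (List.mem_cons_of_mem _ hG)

lemma indepOfEdge_sideProd {d : ℝ} {L : List (Finset (Sym2 (Fin n)))} {e : Sym2 (Fin n)}
    (he : ¬ e.IsDiag) (h : ∀ F ∈ L, e ∉ F) : IndepOfEdge (sideProd d L) e := fun X => by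
  unfold sideProd
  congr 1
  exact List.map_congr_left fun F hF => by rw [indepOfEdge_edgesInd he (h F hF) X]

end Lists

namespace Model

variable (M : Model) {n : ℕ}

/-- The edges of `F` are resampled one at a time. Each indicator becomes a conditional probability
and then `q`, at a cost of `η`; the weight `w` collects the factors `q` already extracted, so the
induction has to allow every `w` in [0, 1]. -/
lemma expect_mul_side_le {d q η : ℝ} (hd : d = 1 ∨ d = -1) (hq0 : 0 ≤ q) (hq1 : q ≤ 1)
    (hη : ∀ e : Sym2 (Fin n), ¬ e.IsDiag → M.prob {X | d * q < d * M.condProb e X} ≤ η)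
    {A : SimpleGraph (Fin n) → ℝ} (hA0 : ∀ X, 0 ≤ A X) (hA1 : ∀ X, A X ≤ 1)
    (F : Finset (Sym2 (Fin n))) (hF : ∀ e ∈ F, ¬ e.IsDiag) (hAF : ∀ e ∈ F, IndepOfEdge A e)
    {w : ℝ} (hw0 : 0 ≤ w) (hw1 : w ≤ 1) :
    M.expect (fun X => A X * side d (w * edgesInd F X)) ≤
      M.expect A * side d (w * q ^ F.card) + F.card * η := by
  classical
  induction F using Finset.induction_on generalizing w with
  | empty => simp [edgesInd, expect_mul_const]
  | insert e F heF ih =>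
    have hed := hF e (Finset.mem_insert_self e F)
    have hAe := hAF e (Finset.mem_insert_self e F)
    have ih' := ih (fun f hf => hF f (Finset.mem_insert_of_mem hf))
      (fun f hf => hAF f (Finset.mem_insert_of_mem hf)) (w := w * q) (mul_nonneg hw0 hq0)
      (mul_le_one₀ hw1 hq0 hq1)
    -- As `side` is affine, the indicator of `e` occurs linearly, with this coefficient.
    have hB : IndepOfEdge (fun X => A X * (d * w * edgesInd F X)) e := fun X => by
      simp only [hAe X, indepOfEdge_edgesInd hed heF X]
    have h1 : M.expect (fun X => A X * side d (w * edgesInd (insert e F) X)) =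
        M.expect (fun X => A X * side d (w * M.condProb e X * edgesInd F X)) := by
      have h2 : ∀ X, A X * side d (w * edgesInd (insert e F) X) =
          A X * ((1 - d) / 2) + A X * (d * w * edgesInd F X) * edgeInd X e := fun X => by
        rw [edgesInd, Finset.prod_insert heF, side, ← edgesInd]
        ring
      have h3 : ∀ X, A X * side d (w * M.condProb e X * edgesInd F X) =
          A X * ((1 - d) / 2) + A X * (d * w * edgesInd F X) * M.condProb e X := fun X => by
        rw [side]
        ring
      simp only [h2, h3]
      rw [expect_add, M.expect_mul_edgeInd hed hB, ← expect_add]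
    have h4 : M.expect (fun X => A X * side d (w * M.condProb e X * edgesInd F X)) ≤
        M.expect (fun X => A X * side d (w * q * edgesInd F X)) +
          M.prob {X | d * q < d * M.condProb e X} := by
      rw [prob_eq_expect, ← expect_add]
      refine M.expect_mono fun X => ?_
      have hc0 := M.condProb_nonneg e X
      have hc1 := M.condProb_le_one e X
      have hf0 := edgesInd_nonneg F X
      have hf1 := edgesInd_le_one F X
      -- On the exceptional event both products lie in [0, 1], so its indicator covers the error;
      -- off it, `d * condProb ≤ d * q` is the required comparison.
      by_cases hX : d * q < d * M.condProb e X
      · rw [Set.indicator_of_mem (by exact hX)]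
        have h5 : A X * side d (w * M.condProb e X * edgesInd F X) ≤ 1 :=
          mul_le_one₀ (hA1 X) (side_nonneg hd (by positivity)
            (mul_le_one₀ (mul_le_one₀ hw1 hc0 hc1) hf0 hf1))
            (side_le_one hd (by positivity) (mul_le_one₀ (mul_le_one₀ hw1 hc0 hc1) hf0 hf1))
        have h6 : 0 ≤ A X * side d (w * q * edgesInd F X) :=
          mul_nonneg (hA0 X) (side_nonneg hd (by positivity)
            (mul_le_one₀ (mul_le_one₀ hw1 hq0 hq1) hf0 hf1))
        linarith
      · rw [Set.indicator_of_notMem (by exact hX), add_zero]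
        refine mul_le_mul_of_nonneg_left ?_ (hA0 X)
        have := mul_le_mul_of_nonneg_left (not_lt.1 hX) (mul_nonneg hw0 hf0)
        simp only [side]
        nlinarith
    rw [h1, Finset.card_insert_of_notMem heF, pow_succ']
    push_cast
    rw [← mul_assoc]
    linarith [hη e hed]

/-- The sets are replaced one after the other; by disjointness, the product over the remaining sets
does not depend on the edges being resampled. -/
lemma expect_sideProd_le {d q η : ℝ} (hd : d = 1 ∨ d = -1) (hq0 : 0 ≤ q) (hq1 : q ≤ 1)
    (hη0 : 0 ≤ η)
    (hη : ∀ e : Sym2 (Fin n), ¬ e.IsDiag → M.prob {X | d * q < d * M.condProb e X} ≤ η)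
    {m N : ℕ} {L : List (Finset (Sym2 (Fin n)))} (hL : IsEdgeFamily m N L) :
    M.expect (sideProd d L) ≤ side d (q ^ m) ^ N + N * (m * η) := by
  induction L generalizing N with
  | nil =>
    obtain rfl : 0 = N := hL.length_eq
    have : (sideProd d [] : SimpleGraph (Fin n) → ℝ) = fun _ => 1 := by ext; simp [sideProd]
    simp [this, expect_const]
  | cons F L ih =>
    obtain ⟨N, rfl⟩ : ∃ k, N = k + 1 := ⟨L.length, by rw [← hL.length_eq, List.length_cons]⟩
    have h1 := M.expect_mul_side_le hd hq0 hq1 hη (A := sideProd d L) (sideProd_nonneg hd L)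
      (sideProd_le_one hd L) F (hL.not_isDiag F List.mem_cons_self)
      (fun e he => indepOfEdge_sideProd (hL.not_isDiag F List.mem_cons_self e he) fun G hG heG =>
        Finset.disjoint_left.1 ((List.pairwise_cons.1 hL.disjoint).1 G hG) he heG)
      zero_le_one le_rfl
    have hm := hL.card_eq F List.mem_cons_self
    simp only [one_mul, hm] at h1
    have hs0 := side_nonneg hd (pow_nonneg hq0 m) (pow_le_one₀ hq0 hq1)
    have hs1 := side_le_one hd (pow_nonneg hq0 m) (pow_le_one₀ hq0 hq1)
    have h2 : M.expect (sideProd d (F :: L)) =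
        M.expect fun X => sideProd d L X * side d (edgesInd F X) := by
      congr 1
      ext X
      rw [sideProd_cons, mul_comm]
    have h3 := mul_le_mul_of_nonneg_right (ih hL.tail) hs0
    have h4 : (N : ℝ) * (m * η) * side d (q ^ m) ≤ N * (m * η) :=
      mul_le_of_le_one_right (by positivity) hs1
    rw [h2, pow_succ]
    push_cast
    nlinarith

/-- The edges of the exponential random graph are asymptotically dominated by independent edges of
probability `q` when `d = 1`, and asymptotically dominate them when `d = -1`, as far as the events
that none of finitely many disjoint bounded edge sets is (for `d = -1`), or that all of them are
(for `d = 1`), contained in the graph can tell. -/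
def Dominated (d q : ℝ) : Prop :=
  ∀ m N : ℕ, ∀ ε > 0, ∀ᶠ n : ℕ in atTop, ∀ L : List (Finset (Sym2 (Fin n))), IsEdgeFamily m N L →
    M.expect (sideProd d L) ≤ side d (q ^ m) ^ N + ε

lemma dominated_of_prob_condProb {d q : ℝ} (hd : d = 1 ∨ d = -1) (hq0 : 0 ≤ q) (hq1 : q ≤ 1)
    (h : ∀ η > 0, ∀ᶠ n : ℕ in atTop, ∀ e : Sym2 (Fin n), ¬ e.IsDiag →
      M.prob {X | d * q < d * M.condProb e X} ≤ η) : M.Dominated d q := by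
  intro m N ε hε
  -- The summand 1 keeps the denominator positive when `N * m = 0`.
  have hpos : 0 < ε / (N * m + 1) := by positivity
  filter_upwards [h _ hpos] with n hn L hL
  refine (M.expect_sideProd_le hd hq0 hq1 hpos.le hn hL).trans ?_
  have : (N : ℝ) * (m * (ε / (N * m + 1))) ≤ ε := by
    rw [← mul_assoc, mul_div_assoc', div_le_iff₀ (by positivity)]
    nlinarith
  linarith

/-- For fixed `m` and `N` the bound is continuous in `q`. This removes the small losses of each
bootstrap step and allows passing to the limit of the iteration. -/
lemma Dominated.of_tendsto {M : Model} {d q : ℝ} {u : ℕ → ℝ} (hu : Tendsto u atTop (nhds q))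
    (h : ∀ k, M.Dominated d (u k)) : M.Dominated d q := by
  intro m N ε hε
  have hc : Tendsto (fun k => side d (u k ^ m) ^ N) atTop (nhds (side d (q ^ m) ^ N)) := by
    unfold side
    exact (((hu.pow m).const_mul d).const_add _).pow N
  obtain ⟨k, hk⟩ := (hc.eventually (gt_mem_nhds (lt_add_of_pos_right _ (half_pos hε)))).exists
  filter_upwards [h k m N (ε / 2) (half_pos hε)] with n hn L hL
  linarith [hn L hL]

lemma dominated_one : M.Dominated 1 1 := by
  intro m N ε hε
  refine Eventually.of_forall fun n L _ => ?_
  have := M.expect_mono (sideProd_le_one (.inl rfl) L)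
  rw [expect_const] at this
  simp [side]
  linarith

lemma dominated_zero : M.Dominated (-1) 0 := by
  intro m N ε hε
  refine Eventually.of_forall fun n L hL => ?_
  -- For `m = 0` the bound is not the trivial one, since `0 ^ 0 = 1`; but then all sets are empty
  -- and the two sides agree exactly.
  rcases Nat.eq_zero_or_pos m with rfl | hm
  · have h1 : sideProd (-1) L = fun _ => (side (-1) (0 ^ 0)) ^ N := by
      ext X
      rw [sideProd, ← hL.length_eq, List.prod_eq_pow_card _ (side (-1) (0 ^ 0)), List.length_map]
      simp only [List.mem_map]
      rintro x ⟨F, hF, rfl⟩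
      rw [Finset.card_eq_zero.1 (hL.card_eq F hF)]
      simp [edgesInd]
    rw [h1, expect_const]
    linarith
  · have := M.expect_mono (sideProd_le_one (.inr rfl) L)
    rw [expect_const] at this
    rw [zero_pow hm.ne']
    norm_num [side]
    linarith

/-! ### Concentration of averages of edge set indicators -/

/-- The average of the indicators of `F t ⊆ E(X)` over `t ∈ T`. -/
def _root_.ERG.avgInd {τ : Type*} (T : Finset τ) (F : τ → Finset (Sym2 (Fin n)))
    (X : SimpleGraph (Fin n)) : ℝ := (∑ t ∈ T, edgesInd (F t) X) / T.card

lemma _root_.ERG.avgInd_nonneg {τ : Type*} (T : Finset τ) (F : τ → Finset (Sym2 (Fin n)))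
    (X : SimpleGraph (Fin n)) : 0 ≤ avgInd T F X :=
  div_nonneg (Finset.sum_nonneg fun t _ => edgesInd_nonneg (F t) X) (Nat.cast_nonneg _)

lemma _root_.ERG.avgInd_le_one {τ : Type*} (T : Finset τ) (F : τ → Finset (Sym2 (Fin n)))
    (X : SimpleGraph (Fin n)) : avgInd T F X ≤ 1 := by
  refine div_le_one_of_le₀ ?_ (Nat.cast_nonneg _)
  simpa using Finset.sum_le_card_nsmul T _ 1 fun t _ => edgesInd_le_one (F t) X

lemma _root_.ERG.side_avgInd {τ : Type*} {T : Finset τ} (hT : T.Nonempty)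
    (F : τ → Finset (Sym2 (Fin n))) (d : ℝ) (X : SimpleGraph (Fin n)) :
    side d (avgInd T F X) = (∑ t ∈ T, side d (edgesInd (F t) X)) / T.card := by
  have : (T.card : ℝ) ≠ 0 := Nat.cast_ne_zero.2 hT.card_pos.ne'
  simp only [side, avgInd, Finset.sum_add_distrib, Finset.sum_const, nsmul_eq_mul,
    ← Finset.mul_sum]
  field_simp

open Classical in
-- One factor of the power is written as an average over `t ∈ T` and `F t` is added to the list. The
-- `t` whose set meets the edges already listed have proportion at most `ε` and contribute at most 1
-- each; the others keep the list an edge family. After `k` such steps the list has `N` members and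
-- `hB` applies.
lemma expect_sideProd_mul_side_avgInd_pow_le {τ : Type*} {T : Finset τ} (hT : T.Nonempty)
    {F : τ → Finset (Sym2 (Fin n))} {d : ℝ} (hd : d = 1 ∨ d = -1) {m N : ℕ} {B ε : ℝ}
    (hB0 : 0 ≤ B) (hε : 0 ≤ ε) (hcard : ∀ t ∈ T, (F t).card = m) (hdiag : ∀ t ∈ T, ∀ e ∈ F t, ¬ e.IsDiag)
    (hB : ∀ L : List (Finset (Sym2 (Fin n))), IsEdgeFamily m N L → M.expect (sideProd d L) ≤ B)
    (hbad : ∀ S : Finset (Sym2 (Fin n)), S.card ≤ N * m →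
      ((T.filter fun t => ¬ Disjoint S (F t)).card : ℝ) ≤ ε * T.card) (k : ℕ) :
    ∀ (j : ℕ) (L : List (Finset (Sym2 (Fin n)))), j + k = N → IsEdgeFamily m j L →
      M.expect (fun X => sideProd d L X * side d (avgInd T F X) ^ k) ≤ B + k * ε := by
  induction k with
  | zero =>
    rintro j L rfl hL
    simpa using hB L hL
  | succ k ih =>
    intro j L hj hL
    have hTpos : (0 : ℝ) < T.card := Nat.cast_pos.2 hT.card_pos
    set r : SimpleGraph (Fin n) → ℝ := fun X => side d (avgInd T F X) with hr
    have hr0 : ∀ X, 0 ≤ r X := fun X => side_nonneg hd (avgInd_nonneg T F X) (avgInd_le_one T F X)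
    have hr1 : ∀ X, r X ≤ 1 := fun X => side_le_one hd (avgInd_nonneg T F X) (avgInd_le_one T F X)
    have h1 : M.expect (fun X => sideProd d L X * r X ^ (k + 1)) =
        (∑ t ∈ T, M.expect fun X => sideProd d (F t :: L) X * r X ^ k) / T.card := by
      rw [← expect_sum, div_eq_mul_inv, ← expect_mul_const]
      congr 1
      ext X
      have : r X = (∑ t ∈ T, side d (edgesInd (F t) X)) / T.card := side_avgInd hT F d X
      simp only [sideProd_cons, ← Finset.sum_mul]
      rw [pow_succ]
      nth_rewrite 2 [this]
      ring
    set S : Finset (Sym2 (Fin n)) := L.toFinset.biUnion id with hS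
    have hScard : S.card ≤ N * m := by
      calc S.card ≤ L.toFinset.card * m := Finset.card_biUnion_le_card_mul _ _ _ fun G hG =>
            (hL.card_eq G (List.mem_toFinset.1 hG)).le
        _ ≤ N * m := Nat.mul_le_mul_right m ((List.toFinset_card_le L).trans
            (by rw [hL.length_eq]; omega))
    have hterm : ∀ t ∈ T, M.expect (fun X => sideProd d (F t :: L) X * r X ^ k) ≤
        (B + k * ε) + if ¬ Disjoint S (F t) then 1 else 0 := by
      intro t ht
      by_cases hdis : Disjoint S (F t)
      · simp only [hdis, not_true_eq_false, if_false, add_zero]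
        refine ih (j + 1) (F t :: L) (by omega) ⟨by simp [hL.length_eq], ?_, ?_, ?_⟩
        · refine List.pairwise_cons.2 ⟨fun G hG => ?_, hL.disjoint⟩
          exact (hdis.mono_left (Finset.subset_biUnion_of_mem id (List.mem_toFinset.2 hG))).symm
        · simpa [hcard t ht] using hL.card_eq
        · intro G hG
          rcases List.mem_cons.1 hG with rfl | hG
          · exact hdiag t ht
          · exact hL.not_isDiag G hG
      · simp only [hdis, not_false_eq_true, if_true]
        have h2 : M.expect (fun X => sideProd d (F t :: L) X * r X ^ k) ≤ 1 := by
          refine (M.expect_mono fun X => ?_).trans_eq (M.expect_const 1)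
          exact mul_le_one₀ (sideProd_le_one hd _ X) (pow_nonneg (hr0 X) k)
            (pow_le_one₀ (hr0 X) (hr1 X))
        have h3 : 0 ≤ B + k * ε := by positivity
        linarith
    rw [h1, div_le_iff₀ hTpos]
    calc _ ≤ ∑ t ∈ T, ((B + k * ε) + if ¬ Disjoint S (F t) then (1 : ℝ) else 0) :=
          Finset.sum_le_sum hterm
      _ = T.card * (B + k * ε) + (T.filter fun t => ¬ Disjoint S (F t)).card := by
          rw [Finset.sum_add_distrib, Finset.sum_const, nsmul_eq_mul, Finset.sum_boole]
      _ ≤ (B + (k + 1 : ℕ) * ε) * T.card := by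
          have := hbad S hScard
          push_cast
          linarith

open Classical in
-- Markov's inequality for the `N'`-th power of `side d (avgInd T F X)`: its expectation is about `b
-- ^ N'`, against the threshold `(b + δ) ^ N'`, and the ratio is small for large `N'`.
lemma Dominated.exists_prob_avgInd_le {M : Model} {d q : ℝ} (h : M.Dominated d q)
    (hd : d = 1 ∨ d = -1) (hq0 : 0 ≤ q) (hq1 : q ≤ 1) (m : ℕ) {δ η : ℝ} (hδ : 0 < δ)
    (hη : 0 < η) :
    ∃ (K : ℕ) (ε : ℝ), 0 < ε ∧ ∀ᶠ n : ℕ in atTop, ∀ (τ : Type) (T : Finset τ)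
      (F : τ → Finset (Sym2 (Fin n))), T.Nonempty → (∀ t ∈ T, (F t).card = m) →
      (∀ t ∈ T, ∀ e ∈ F t, ¬ e.IsDiag) →
      (∀ S : Finset (Sym2 (Fin n)), S.card ≤ K →
        ((T.filter fun t => ¬ Disjoint S (F t)).card : ℝ) ≤ ε * T.card) →
      M.prob {X | d * q ^ m + δ < d * avgInd T F X} ≤ η := by
  set b := side d (q ^ m) with hb
  have hb0 : 0 ≤ b := side_nonneg hd (pow_nonneg hq0 m) (pow_le_one₀ hq0 hq1)
  have hbδ : 0 < b + δ := by linarith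
  obtain ⟨N, hN⟩ := exists_pow_lt_of_lt_one (half_pos hη)
    ((div_lt_one hbδ).2 (lt_add_of_pos_right b hδ))
  have hN' : (b / (b + δ)) ^ (N + 1) < η / 2 :=
    (pow_le_pow_of_le_one (by positivity) ((div_lt_one hbδ).2 (lt_add_of_pos_right b hδ)).le
      (Nat.le_succ N)).trans_lt hN
  -- The exponent must be nonzero for strict monotonicity of the power.
  set N' := N + 1 with hNdef
  have hpow : 0 < (b + δ) ^ N' := pow_pos hbδ N'
  -- Chosen so that the total error `(1 + N') * ε` is `η / 2` times the threshold: one `ε` comes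
  -- from domination and `N'` of them from overlapping sets.
  set ε := η / 2 * (b + δ) ^ N' / (1 + N') with hεdef
  have hε : 0 < ε := by positivity
  refine ⟨N' * m, ε, hε, ?_⟩
  filter_upwards [h m N' ε hε] with n hn τ T F hT hcard hdiag hbad
  have h1 := M.expect_sideProd_mul_side_avgInd_pow_le hT hd (B := b ^ N' + ε) (by positivity) hε.le
    hcard hdiag hn hbad N' 0 [] (by simp) ⟨rfl, List.Pairwise.nil, by simp, by simp⟩
  have h2 : M.prob {X | d * q ^ m + δ < d * avgInd T F X} ≤
      M.prob {X | (b + δ) ^ N' < sideProd d [] X * side d (avgInd T F X) ^ N'} := by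
    refine M.prob_mono fun X hX => ?_
    have hX' : d * q ^ m + δ < d * avgInd T F X := hX
    have : b + δ < side d (avgInd T F X) := by
      simp only [hb, side]
      linarith
    simpa [sideProd] using pow_lt_pow_left₀ this hbδ.le (Nat.succ_ne_zero N)
  have h3 := M.mul_prob_le_expect (f := fun X => sideProd d [] X * side d (avgInd T F X) ^ N')
    (fun X => mul_nonneg (sideProd_nonneg hd _ X)
      (pow_nonneg (side_nonneg hd (avgInd_nonneg T F X) (avgInd_le_one T F X)) N'))
    ((b + δ) ^ N')
  have h4 : (1 + N') * ε = η / 2 * (b + δ) ^ N' := by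
    rw [hεdef]
    field_simp
  have h5 : b ^ N' ≤ η / 2 * (b + δ) ^ N' := by
    rw [div_pow, div_lt_iff₀ hpow] at hN'
    exact hN'.le
  refine h2.trans (le_of_mul_le_mul_left ?_ hpow)
  calc _ ≤ b ^ N' + ε + N' * ε := h3.trans h1
    _ = b ^ N' + (1 + N') * ε := by ring
    _ ≤ _ := by rw [h4]; linarith

end Model

/-! ### Copies of a graph through a given edge -/

section Copies

variable {v n : ℕ}

open Classical in
/-- The image of the edge set of `G` under a map of vertices. -/
def imgEdges (G : SimpleGraph (Fin v)) (φ : Fin v → Fin n) : Finset (Sym2 (Fin n)) :=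
  G.edgeFinset.image (Sym2.map φ)

open Classical in
/-- The injective maps of vertices under which some edge of `G` is mapped to `e`. -/
def mapsThrough (G : SimpleGraph (Fin v)) (e : Sym2 (Fin n)) : Finset (Fin v → Fin n) :=
  Finset.univ.filter fun φ => Function.Injective φ ∧ e ∈ imgEdges G φ

open Classical in
/-- The edges different from `e` of the image of `G`. -/
def otherEdges (G : SimpleGraph (Fin v)) (e : Sym2 (Fin n)) (φ : Fin v → Fin n) :
    Finset (Sym2 (Fin n)) := (imgEdges G φ).erase e

lemma mem_imgEdges {G : SimpleGraph (Fin v)} {φ : Fin v → Fin n} {e : Sym2 (Fin n)} :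
    e ∈ imgEdges G φ ↔ ∃ g ∈ G.edgeSet, Sym2.map φ g = e := by
  simp [imgEdges]

lemma card_edgeFinset_eq_edgeCount {V : Type*} (G : SimpleGraph V) [Fintype G.edgeSet] :
    G.edgeFinset.card = edgeCount G := by
  rw [edgeCount, Nat.card_eq_fintype_card, SimpleGraph.edgeFinset_card]

lemma card_imgEdges (G : SimpleGraph (Fin v)) {φ : Fin v → Fin n} (hφ : Function.Injective φ) :
    (imgEdges G φ).card = edgeCount G := by
  classical
  rw [imgEdges, Finset.card_image_of_injective _ (Sym2.map.injective hφ),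
    card_edgeFinset_eq_edgeCount]

lemma not_isDiag_of_mem_imgEdges {G : SimpleGraph (Fin v)} {φ : Fin v → Fin n}
    (hφ : Function.Injective φ) {e : Sym2 (Fin n)} (he : e ∈ imgEdges G φ) : ¬ e.IsDiag := by
  obtain ⟨g, hg, rfl⟩ := mem_imgEdges.1 he
  rw [Sym2.isDiag_map hφ]
  exact G.not_isDiag_of_mem_edgeSet hg

lemma imgEdges_subset_iff {G : SimpleGraph (Fin v)} {φ : Fin v → Fin n}
    {X : SimpleGraph (Fin n)} :
    (imgEdges G φ : Set (Sym2 (Fin n))) ⊆ X.edgeSet ↔ ∀ i j, G.Adj i j → X.Adj (φ i) (φ j) := by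
  constructor
  · intro h i j hij
    exact h (mem_imgEdges.2 ⟨s(i, j), hij, rfl⟩)
  · intro h e he
    obtain ⟨g, hg, rfl⟩ := mem_imgEdges.1 he
    induction g using Sym2.ind with
    | _ i j => exact h i j hg

lemma copyCount_eq_natCard (G : SimpleGraph (Fin v)) (X : SimpleGraph (Fin n)) :
    copyCount G X = Nat.card (G.Copy X) := by
  unfold copyCount SimpleGraph.labelledCopyCount
  exact Fintype.card_eq_nat_card

open Classical in
lemma copyCount_eq_sum (G : SimpleGraph (Fin v)) (X : SimpleGraph (Fin n)) :
    (copyCount G X : ℝ) =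
      ∑ φ : Fin v → Fin n with Function.Injective φ, edgesInd (imgEdges G φ) X := by
  have h1 : ∀ φ : Fin v → Fin n, edgesInd (imgEdges G φ) X =
      if ∀ i j, G.Adj i j → X.Adj (φ i) (φ j) then 1 else 0 := fun φ => by
    split_ifs with h
    · exact edgesInd_of_subset (imgEdges_subset_iff.2 h)
    · exact edgesInd_of_not_subset fun h' => h (imgEdges_subset_iff.1 h')
  simp only [h1]
  have equiv : G.Copy X ≃ {φ : Fin v → Fin n // Function.Injective φ ∧
      ∀ i j, G.Adj i j → X.Adj (φ i) (φ j)} :=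
    { toFun := fun f => ⟨f.toHom, f.injective', fun _ _ h => f.toHom.map_rel h⟩
      invFun := fun φ => ⟨⟨φ.1, fun {i j} h => φ.2.2 i j h⟩, φ.2.1⟩
      left_inv := fun _ => rfl
      right_inv := fun _ => rfl }
  rw [Finset.sum_boole, Finset.filter_filter, copyCount_eq_natCard, Nat.card_congr equiv, Nat.card_eq_fintype_card,
    Fintype.card_subtype]

lemma copyCount_addEdge_sub_removeEdge (G : SimpleGraph (Fin v)) (X : SimpleGraph (Fin n))
    {e : Sym2 (Fin n)} (he : ¬ e.IsDiag) :
    (copyCount G (addEdge X e) : ℝ) - copyCount G (removeEdge X e) =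
      ∑ φ ∈ mapsThrough G e, edgesInd (otherEdges G e φ) X := by
  classical
  rw [copyCount_eq_sum, copyCount_eq_sum, ← Finset.sum_sub_distrib, mapsThrough,
    ← Finset.filter_filter, Finset.sum_filter (fun φ => e ∈ imgEdges G φ)]
  refine Finset.sum_congr rfl fun φ _ => ?_
  split_ifs with h
  · have h1 : edgesInd (imgEdges G φ) (removeEdge X e) = 0 :=
      Finset.prod_eq_zero h (edgeInd_of_notMem (by simp [edgeSet_removeEdge X he]))
    have h2 : edgeInd (addEdge X e) e = 1 := edgeInd_of_mem (by simp [edgeSet_addEdge X he])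
    rw [h1, sub_zero, edgesInd, ← Finset.mul_prod_erase _ _ h, h2, one_mul]
    exact (indepOfEdge_edgesInd he (Finset.notMem_erase e _)).addEdge X
  · rw [indepOfEdge_edgesInd he h X, sub_self]

lemma card_otherEdges {G : SimpleGraph (Fin v)} {e : Sym2 (Fin n)} {φ : Fin v → Fin n}
    (h : φ ∈ mapsThrough G e) : (otherEdges G e φ).card = edgeCount G - 1 := by
  classical
  obtain ⟨-, hφ, he⟩ := Finset.mem_filter.1 h
  rw [otherEdges, Finset.card_erase_of_mem he, card_imgEdges G hφ]

lemma not_isDiag_of_mem_otherEdges {G : SimpleGraph (Fin v)} {e f : Sym2 (Fin n)}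
    {φ : Fin v → Fin n} (h : φ ∈ mapsThrough G e) (hf : f ∈ otherEdges G e φ) : ¬ f.IsDiag := by
  classical
  obtain ⟨-, hφ, he⟩ := Finset.mem_filter.1 h
  exact not_isDiag_of_mem_imgEdges hφ (Finset.mem_of_mem_erase hf)

lemma exists_perm_map_eq {α : Type*} {e f : Sym2 α} (he : ¬ e.IsDiag) (hf : ¬ f.IsDiag) :
    ∃ π : Equiv.Perm α, Sym2.map π e = f := by
  classical
  induction e using Sym2.ind with
  | _ a b =>
  induction f using Sym2.ind with
  | _ c d =>
  rw [Sym2.mk_isDiag_iff] at he hf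
  -- The first swap sends `a` to `c`; the second sends the image of `b` to `d` and fixes `c`.
  refine ⟨(Equiv.swap a c).trans (Equiv.swap (Equiv.swap a c b) d), ?_⟩
  have h1 : c ≠ Equiv.swap a c b := fun h => he ((Equiv.swap a c).injective
    ((Equiv.swap_apply_left a c).trans h))
  simp [Sym2.map_mk, Equiv.swap_apply_of_ne_of_ne h1 hf]

lemma imgEdges_comp (G : SimpleGraph (Fin v)) (φ : Fin v → Fin n) (π : Equiv.Perm (Fin n))
    (e : Sym2 (Fin n)) : Sym2.map π e ∈ imgEdges G (π ∘ φ) ↔ e ∈ imgEdges G φ := by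
  simp only [mem_imgEdges, ← Sym2.map_map]
  exact exists_congr fun g => and_congr_right fun _ => (Sym2.map.injective π.injective).eq_iff

lemma card_mapsThrough_eq (G : SimpleGraph (Fin v)) {e f : Sym2 (Fin n)} (he : ¬ e.IsDiag)
    (hf : ¬ f.IsDiag) : (mapsThrough G e).card = (mapsThrough G f).card := by
  classical
  obtain ⟨π, rfl⟩ := exists_perm_map_eq he hf
  refine Finset.card_equiv (Equiv.arrowCongr (Equiv.refl _) π) fun φ => ?_
  simp only [mapsThrough, Finset.mem_filter, Finset.mem_univ, true_and]
  change _ ↔ Function.Injective (π ∘ φ) ∧ Sym2.map π e ∈ imgEdges G (π ∘ φ)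
  rw [imgEdges_comp, π.injective.of_comp_iff]

open Classical in
lemma card_filter_injective (V : Type*) [Fintype V] [DecidableEq V] (n : ℕ) :
    (Finset.univ.filter fun φ : V → Fin n => Function.Injective φ).card =
      n.descFactorial (Fintype.card V) := by
  rw [← Fintype.card_subtype, Fintype.card_congr (Equiv.subtypeInjectiveEquivEmbedding _ _),
    Fintype.card_embedding_eq, Fintype.card_fin]

/-- Double counting of pairs of a possible edge and an injective map whose image of `G` contains it;
by symmetry each possible edge lies in equally many images. -/
lemma card_mapsThrough (G : SimpleGraph (Fin v)) {e : Sym2 (Fin n)} (he : ¬ e.IsDiag) :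
    (mapsThrough G e).card * n.choose 2 = edgeCount G * n.descFactorial v := by
  classical
  set D : Finset (Sym2 (Fin n)) := Finset.univ.filter fun f => ¬ f.IsDiag with hD
  have hDcard : D.card = n.choose 2 := by
    rw [hD, ← Fintype.card_subtype, Sym2.card_subtype_not_diag, Fintype.card_fin]
  have h1 := Finset.sum_card_bipartiteAbove_eq_sum_card_bipartiteBelow
    (s := D) (t := Finset.univ.filter fun φ : Fin v → Fin n => Function.Injective φ)
    (fun f φ => f ∈ imgEdges G φ)
  rw [Finset.sum_congr rfl (g := fun _ => (mapsThrough G e).card), Finset.sum_const, hDcard,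
    smul_eq_mul, Finset.sum_congr rfl (g := fun _ => edgeCount G), Finset.sum_const,
    card_filter_injective, smul_eq_mul, Fintype.card_fin] at h1
  · rw [mul_comm, h1, mul_comm]
  · intro φ hφ
    have hφ' := (Finset.mem_filter.1 hφ).2
    rw [← card_imgEdges G hφ', Finset.bipartiteBelow]
    congr 1
    ext f
    simp only [hD, Finset.mem_filter, Finset.mem_univ, true_and, and_iff_right_iff_imp]
    exact not_isDiag_of_mem_imgEdges hφ'
  · intro f hf
    rw [card_mapsThrough_eq G he (Finset.mem_filter.1 hf).2, mapsThrough, Finset.bipartiteAbove,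
      Finset.filter_filter]

open Classical in
lemma card_maps_three {i j k : Fin v} (hij : i ≠ j) (hik : i ≠ k) (hjk : j ≠ k) (x y z : Fin n) :
    (Finset.univ.filter fun φ : Fin v → Fin n => φ i = x ∧ φ j = y ∧ φ k = z).card * n ^ 3 =
      n ^ v := by
  have h1 : (Finset.univ.filter fun φ : Fin v → Fin n => φ i = x ∧ φ j = y ∧ φ k = z) =
      Fintype.piFinset fun w => if w = i then {x} else if w = j then {y} else
        if w = k then {z} else Finset.univ := by
    ext φ
    simp only [Finset.mem_filter, Finset.mem_univ, true_and, Fintype.mem_piFinset]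
    constructor
    · rintro ⟨hi, hj, hk⟩ w
      split_ifs with h1 h2 h3
      · simp [h1, hi]
      · simp [h2, hj]
      · simp [h3, hk]
      · simp
    · intro h
      have hi := h i
      have hj := h j
      have hk := h k
      simp only [hij.symm, hik.symm, hjk.symm, if_true, if_false, Finset.mem_singleton] at hi hj hk
      exact ⟨hi, hj, hk⟩
  have h2 : n ^ 3 = ∏ w : Fin v, if w ∈ ({i, j, k} : Finset (Fin v)) then n else 1 := by
    rw [Finset.prod_ite_mem, Finset.univ_inter, Finset.prod_const,
      Finset.card_eq_three.2 ⟨i, j, k, hij, hik, hjk, rfl⟩]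
  rw [h1, Fintype.card_piFinset, h2, ← Finset.prod_mul_distrib]
  rw [Finset.prod_congr rfl (g := fun _ => n), Finset.prod_const, Finset.card_univ, Fintype.card_fin]
  intro w _
  by_cases h1 : w = i
  · simp [h1]
  by_cases h2 : w = j
  · simp [h2, hij.symm]
  by_cases h3 : w = k
  · simp [h3, hik.symm, hjk.symm]
  · simp [h1, h2, h3]

open Classical in
-- An image edge in `S` other than `e` has an end outside `e`. So three distinct vertices of `G`
-- have prescribed images: the ends of `e` and an end of a member of `S`. There are at most 2|S|v³
-- such prescriptions, and each leaves n^(v-3) maps, one power of n fewer than the number of maps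
-- through `e`. Multiplying by `n ^ 3` avoids a truncated exponent.
lemma card_mapsThrough_not_disjoint_le (G : SimpleGraph (Fin v)) (e : Sym2 (Fin n))
    (S : Finset (Sym2 (Fin n))) :
    ((mapsThrough G e).filter fun φ => ¬ Disjoint S (otherEdges G e φ)).card * n ^ 3 ≤
      2 * S.card * v ^ 3 * n ^ v := by
  induction e using Sym2.ind with
  | _ x y =>
  set W : Finset (Fin n) := S.biUnion Sym2.toFinset with hW
  have hWcard : W.card ≤ 2 * S.card := by
    rw [mul_comm]
    refine Finset.card_biUnion_le_card_mul _ _ _ fun f _ => ?_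
    rw [Sym2.card_toFinset]
    split_ifs <;> omega
  set I : Finset (Fin n × Fin v × Fin v × Fin v) :=
    (W ×ˢ Finset.univ).filter fun t => t.2.1 ≠ t.2.2.1 ∧ t.2.1 ≠ t.2.2.2 ∧ t.2.2.1 ≠ t.2.2.2
    with hI
  have hIcard : I.card ≤ 2 * S.card * v ^ 3 := by
    refine (Finset.card_filter_le _ _).trans ?_
    rw [Finset.card_product, Finset.card_univ]
    simp only [Fintype.card_prod, Fintype.card_fin]
    calc W.card * (v * (v * v)) ≤ 2 * S.card * (v * (v * v)) := Nat.mul_le_mul_right _ hWcard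
      _ = _ := by ring
  have hsub : ((mapsThrough G s(x, y)).filter fun φ => ¬ Disjoint S (otherEdges G s(x, y) φ)) ⊆
      I.biUnion fun t => Finset.univ.filter fun φ : Fin v → Fin n =>
        φ t.2.1 = x ∧ φ t.2.2.1 = y ∧ φ t.2.2.2 = t.1 := by
    intro φ hφ
    obtain ⟨hφ1, hφ2⟩ := Finset.mem_filter.1 hφ
    obtain ⟨-, hinj, he⟩ := Finset.mem_filter.1 hφ1
    obtain ⟨f, hfS, hf⟩ := Finset.not_disjoint_iff.1 hφ2
    obtain ⟨hfe, hf⟩ := Finset.mem_erase.1 hf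
    obtain ⟨i, j, hi, hj⟩ : ∃ i j, φ i = x ∧ φ j = y := by
      obtain ⟨g, -, hg⟩ := mem_imgEdges.1 he
      induction g using Sym2.ind with
      | _ i j =>
      rw [Sym2.map_mk, Sym2.eq_iff] at hg
      rcases hg with h | h
      · exact ⟨i, j, h⟩
      · exact ⟨j, i, h.2, h.1⟩
    have hxy : x ≠ y := by simpa using not_isDiag_of_mem_imgEdges hinj he
    have hfd := not_isDiag_of_mem_imgEdges hinj hf
    obtain ⟨k, hkf, hkx, hky⟩ : ∃ k, φ k ∈ f ∧ φ k ≠ x ∧ φ k ≠ y := by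
      obtain ⟨g, -, rfl⟩ := mem_imgEdges.1 hf
      induction g using Sym2.ind with
      | _ a b =>
      rw [Sym2.map_mk] at hfe hfd ⊢
      rw [Sym2.mk_isDiag_iff] at hfd
      rw [ne_eq, Sym2.eq_iff] at hfe
      by_cases ha : φ a ≠ x ∧ φ a ≠ y
      · exact ⟨a, Sym2.mem_mk_left _ _, ha.1, ha.2⟩
      · refine ⟨b, Sym2.mem_mk_right _ _, ?_, ?_⟩ <;> grind
    refine Finset.mem_biUnion.2 ⟨(φ k, i, j, k), ?_, ?_⟩
    · simp only [hI, hW, Finset.mem_filter, Finset.mem_product, Finset.mem_biUnion,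
        Finset.mem_univ, and_true, Sym2.mem_toFinset]
      refine ⟨⟨f, hfS, hkf⟩, ?_, ?_, ?_⟩
      · rintro rfl
        exact hxy (hi.symm.trans hj)
      · rintro rfl
        exact hkx hi
      · rintro rfl
        exact hky hj
    · simp [hi, hj]
  calc _ ≤ (∑ t ∈ I, (Finset.univ.filter fun φ : Fin v → Fin n =>
        φ t.2.1 = x ∧ φ t.2.2.1 = y ∧ φ t.2.2.2 = t.1).card) * n ^ 3 :=
        Nat.mul_le_mul_right _ ((Finset.card_le_card hsub).trans Finset.card_biUnion_le)
    _ = ∑ t ∈ I, n ^ v := by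
        rw [Finset.sum_mul]
        refine Finset.sum_congr rfl fun t ht => ?_
        obtain ⟨h1, h2, h3⟩ := (Finset.mem_filter.1 ht).2
        exact card_maps_three h1 h2 h3 x y t.1
    _ ≤ _ := by
        rw [Finset.sum_const, smul_eq_mul]
        exact Nat.mul_le_mul_right _ hIcard

end Copies

/-! ### Asymptotic numbers of copies through an edge -/

lemma tendsto_descFactorial_div_pow (v : ℕ) :
    Tendsto (fun n : ℕ => (n.descFactorial v : ℝ) / (n : ℝ) ^ v) atTop (nhds 1) := by
  have h := isEquivalent_descFactorial v
  refine (isEquivalent_iff_tendsto_one ?_).1 h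
  filter_upwards [eventually_gt_atTop 0] with n hn
  positivity

/-- The normalized number of injective maps of the vertices of `G` that map some edge of `G` to a
given edge. -/
def normCount {v : ℕ} (G : SimpleGraph (Fin v)) (n : ℕ) : ℝ :=
  edgeCount G * ((n.descFactorial v : ℝ) / (n : ℝ) ^ v) * (2 * (n / (n - 1)))

lemma tendsto_normCount {v : ℕ} (G : SimpleGraph (Fin v)) :
    Tendsto (normCount G) atTop (nhds (2 * edgeCount G)) := by
  have h1 : Tendsto (fun n : ℕ => (n : ℝ) / (n - 1)) atTop (nhds 1) := by
    have h2 : Tendsto (fun n : ℕ => 1 + 1 / ((n : ℝ) - 1)) atTop (nhds (1 + 0)) :=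
      (tendsto_const_nhds.div_atTop
        (tendsto_atTop_add_const_right _ (-1) tendsto_natCast_atTop_atTop)).const_add 1
    rw [add_zero] at h2
    refine h2.congr' ?_
    filter_upwards [eventually_gt_atTop 1] with n hn
    have : (n : ℝ) - 1 ≠ 0 := by
      have : (1 : ℝ) < n := by exact_mod_cast hn
      linarith
    field_simp
    ring
  have h := ((tendsto_descFactorial_div_pow v).const_mul (edgeCount G : ℝ)).mul (h1.const_mul 2)
  have h3 : (edgeCount G : ℝ) * 1 * (2 * 1) = 2 * edgeCount G := by ring
  rw [h3] at h
  exact h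

lemma card_mapsThrough_div {v n : ℕ} (G : SimpleGraph (Fin v)) {e : Sym2 (Fin n)}
    (he : ¬ e.IsDiag) (hn : 1 < n) :
    ((mapsThrough G e).card : ℝ) / (n : ℝ) ^ ((v : ℤ) - 2) = normCount G n := by
  have h := congrArg (Nat.cast : ℕ → ℝ) (card_mapsThrough G he)
  push_cast [Nat.cast_choose_two] at h
  have hn1 : (1 : ℝ) < n := by exact_mod_cast hn
  have hn0 : (n : ℝ) ≠ 0 := by positivity
  have hn2 : (n : ℝ) - 1 ≠ 0 := by linarith
  rw [normCount, zpow_sub₀ hn0, zpow_natCast, zpow_ofNat]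
  field_simp
  linarith

open Classical in
lemma eventually_card_mapsThrough_not_disjoint_le {v : ℕ} (G : SimpleGraph (Fin v))
    (hG : 0 < edgeCount G) (K : ℕ) {ε : ℝ} (hε : 0 < ε) :
    ∀ᶠ n : ℕ in atTop, ∀ e : Sym2 (Fin n), ¬ e.IsDiag → (mapsThrough G e).Nonempty ∧
      ∀ S : Finset (Sym2 (Fin n)), S.card ≤ K →
        (((mapsThrough G e).filter fun φ => ¬ Disjoint S (otherEdges G e φ)).card : ℝ) ≤
          ε * (mapsThrough G e).card := by
  have hG' : (1 : ℝ) ≤ edgeCount G := by exact_mod_cast hG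
  -- The limit is at least 2, so more than n^(v-2) maps pass through `e`, against O(n^(v-3)) that
  -- meet `S`.
  have h1 : ∀ᶠ n : ℕ in atTop, 1 < normCount G n :=
    (tendsto_normCount G).eventually (lt_mem_nhds (by linarith))
  have h2 : ∀ᶠ n : ℕ in atTop, 2 * K * v ^ 3 / ε ≤ (n : ℝ) :=
    tendsto_natCast_atTop_atTop.eventually_ge_atTop _
  filter_upwards [h1, h2, eventually_gt_atTop 1] with n hn1 hn2 hn e he
  have hnpos : (0 : ℝ) < n := by positivity
  rw [← card_mapsThrough_div G he hn, zpow_sub₀ hnpos.ne', zpow_natCast, zpow_ofNat,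
    one_lt_div (by positivity), div_lt_iff₀ (by positivity)] at hn1
  refine ⟨?_, fun S hS => ?_⟩
  · rw [Finset.nonempty_iff_ne_empty]
    intro h
    rw [h] at hn1
    simp only [Finset.card_empty, Nat.cast_zero, zero_mul] at hn1
    exact absurd hn1 (not_lt.2 (by positivity))
  · have h3 : (((mapsThrough G e).filter fun φ => ¬ Disjoint S (otherEdges G e φ)).card : ℝ) *
        (n : ℝ) ^ 3 ≤ 2 * S.card * v ^ 3 * n ^ v := by
      exact_mod_cast card_mapsThrough_not_disjoint_le G e S
    have hS' : (S.card : ℝ) ≤ K := by exact_mod_cast hS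
    rw [div_le_iff₀ hε] at hn2
    refine le_of_mul_le_mul_right ?_ (pow_pos hnpos 3)
    calc _ ≤ 2 * S.card * v ^ 3 * (n : ℝ) ^ v := h3
      _ ≤ 2 * K * v ^ 3 * ((mapsThrough G e).card * (n : ℝ) ^ 2) := by gcongr
      _ ≤ (n * ε) * ((mapsThrough G e).card * (n : ℝ) ^ 2) := by gcongr
      _ = _ := by ring

namespace Model

/-! ### One step of the fixed point iteration -/

/-- The change in the count is `normCount G n`, which tends to 2|E|, times an average to which
`Dominated.exists_prob_avgInd_le` applies. A weight `b ≥ 0` preserves the direction of the estimate;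
for a graph with one edge the average is identically 1, so the sign of `b` does not matter. -/
lemma Dominated.eventually_prob_copyCount_le {M : Model} {d q : ℝ} (h : M.Dominated d q)
    (hd : d = 1 ∨ d = -1) (hq0 : 0 ≤ q) (hq1 : q ≤ 1) {v : ℕ} (G : SimpleGraph (Fin v))
    {b : ℝ} (hb : 0 ≤ b ∨ edgeCount G = 1) {δ η : ℝ} (hδ : 0 < δ) (hη : 0 < η) :
    ∀ᶠ n : ℕ in atTop, ∀ e : Sym2 (Fin n), ¬ e.IsDiag →
      M.prob {X | d * (2 * b * edgeCount G * q ^ (edgeCount G - 1)) + δ <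
        d * (b * (copyCount G (addEdge X e) / (n : ℝ) ^ ((v : ℤ) - 2)) -
          b * (copyCount G (removeEdge X e) / (n : ℝ) ^ ((v : ℤ) - 2)))} ≤ η := by
  have hsub : ∀ {n : ℕ} {e : Sym2 (Fin n)}, ¬ e.IsDiag → 1 < n → ∀ X,
      b * (copyCount G (addEdge X e) / (n : ℝ) ^ ((v : ℤ) - 2)) -
        b * (copyCount G (removeEdge X e) / (n : ℝ) ^ ((v : ℤ) - 2)) =
      b * (normCount G n * avgInd (mapsThrough G e) (otherEdges G e) X) := by
    intro n e he hn X
    rw [← card_mapsThrough_div G he hn, avgInd, ← mul_sub, ← sub_div,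
      copyCount_addEdge_sub_removeEdge G X he]
    rcases Finset.eq_empty_or_nonempty (mapsThrough G e) with h0 | h0
    · simp [h0]
    · have : ((mapsThrough G e).card : ℝ) ≠ 0 := Nat.cast_ne_zero.2 h0.card_pos.ne'
      field_simp
  rcases Nat.eq_zero_or_pos (edgeCount G) with hG | hG
  · filter_upwards [eventually_gt_atTop 1] with n hn e he
    simp only [hsub he hn, normCount, hG]
    have : {X : SimpleGraph (Fin n) | d * (2 * b * ((0 : ℕ) : ℝ) * q ^ (0 - 1)) + δ < d * (b *
        (((0 : ℕ) : ℝ) * ((n.descFactorial v : ℝ) / (n : ℝ) ^ v) * (2 * (n / (n - 1))) *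
          avgInd (mapsThrough G e) (otherEdges G e) X))} = ∅ := by
      ext X
      simp [hδ.le]
    rw [this, prob_eq_expect]
    simp only [Set.indicator_empty, expect_const]
    exact hη.le
  set m := edgeCount G - 1 with hm
  have hG' : (0 : ℝ) < edgeCount G := by exact_mod_cast hG
  -- Half of `δ` pays for the deviation of the average, the other half for that of `normCount G n`
  -- from its limit.
  set δ' : ℝ := δ / (2 * (2 * |b| * edgeCount G + 1)) with hδ'
  have hδ'pos : 0 < δ' := by positivity
  have hδ'le : 2 * |b| * edgeCount G * δ' ≤ δ / 2 := by
    rw [hδ', mul_div_assoc', div_le_iff₀ (by positivity)]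
    nlinarith [abs_nonneg b]
  obtain ⟨K, ε, hε, hK⟩ := h.exists_prob_avgInd_le hd hq0 hq1 m hδ'pos hη
  have hnc : ∀ᶠ n : ℕ in atTop, |b| * |normCount G n - 2 * edgeCount G| < δ / 2 := by
    have h1 : Tendsto (fun n => |b| * |normCount G n - 2 * edgeCount G|) atTop
        (nhds (|b| * |2 * (edgeCount G : ℝ) - 2 * edgeCount G|)) :=
      (((tendsto_normCount G).sub_const _).abs).const_mul _
    rw [sub_self, abs_zero, mul_zero] at h1
    exact h1.eventually (gt_mem_nhds (half_pos hδ))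
  filter_upwards [hK, hnc, eventually_card_mapsThrough_not_disjoint_le G hG K hε,
    eventually_gt_atTop 1] with n hn hn1 hn2 hn3 e he
  obtain ⟨hne, hbad⟩ := hn2 e he
  have hcard : ∀ φ ∈ mapsThrough G e, (otherEdges G e φ).card = m := fun φ hφ => card_otherEdges hφ
  refine (M.prob_mono fun X hX => ?_).trans (hn (Fin v → Fin n) (mapsThrough G e) (otherEdges G e)
    hne hcard (fun φ hφ f hf => not_isDiag_of_mem_otherEdges hφ hf) (fun S hS => by
      convert hbad S hS))
  have hX' : d * (2 * b * edgeCount G * q ^ m) + δ < d * (b * (normCount G n *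
      avgInd (mapsThrough G e) (otherEdges G e) X)) := by
    rw [← hsub he hn3]
    exact hX
  set r := avgInd (mapsThrough G e) (otherEdges G e) X with hr
  have hr0 : 0 ≤ r := avgInd_nonneg _ _ X
  have hr1 : r ≤ 1 := avgInd_le_one _ _ X
  have hd1 : |d| = 1 := by rcases hd with rfl | rfl <;> simp
  have h3 : d * b * (normCount G n - 2 * edgeCount G) * r < δ / 2 := by
    refine (le_abs_self _).trans_lt (lt_of_le_of_lt ?_ hn1)
    rw [abs_mul, abs_mul, abs_mul, hd1, one_mul, abs_of_nonneg hr0]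
    exact mul_le_of_le_one_right (by positivity) hr1
  have h4 : δ / 2 < d * b * (2 * edgeCount G) * (r - q ^ m) := by
    nlinarith
  change d * q ^ m + δ' < d * r
  by_contra hcon
  rw [not_lt] at hcon
  rcases hb with hb | hb
  · rw [abs_of_nonneg hb] at hδ'le
    have h5 : d * (r - q ^ m) ≤ δ' := by linarith
    have h6 := mul_le_mul_of_nonneg_left h5 (show 0 ≤ 2 * b * edgeCount G by positivity)
    nlinarith
  · have hm0 : m = 0 := by omega
    have hr' : r = 1 := by
      rw [hr, avgInd, Finset.sum_congr rfl (g := fun _ => 1)]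
      · have : ((mapsThrough G e).card : ℝ) ≠ 0 := Nat.cast_ne_zero.2 hne.card_pos.ne'
        simp [this]
      · intro φ hφ
        rw [Finset.card_eq_zero.1 ((hcard φ hφ).trans hm0)]
        simp [edgesInd]
    rw [hr', hm0, pow_zero, sub_self, mul_zero] at h4
    linarith

lemma edgeCount_first (M : Model) : edgeCount (M.G 0) = 1 := by
  have h := congrArg (fun s : Σ m : ℕ, SimpleGraph (Fin m) => edgeCount s.2) M.edge_first
  have h2 : edgeCount (⊤ : SimpleGraph (Fin 2)) = 1 := by
    rw [← card_edgeFinset_eq_edgeCount, SimpleGraph.card_edgeFinset_top_eq_card_choose_two]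
    simp
  exact h.trans h2

lemma Dominated.eventually_prob_energyGap_le {M : Model} {d q : ℝ} (h : M.Dominated d q)
    (hd : d = 1 ∨ d = -1) (hq0 : 0 ≤ q) (hq1 : q ≤ 1) {δ η : ℝ} (hδ : 0 < δ) (hη : 0 < η) :
    ∀ᶠ n : ℕ in atTop, ∀ e : Sym2 (Fin n), ¬ e.IsDiag →
      M.prob {X | d * M.psi q + δ < d * M.energyGap e X} ≤ η := by
  have hs : (0 : ℝ) < M.s + 1 := by positivity
  have h1 : ∀ᶠ n : ℕ in atTop, ∀ i : Fin (M.s + 1), ∀ e : Sym2 (Fin n), ¬ e.IsDiag →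
      M.prob {X | d * (2 * M.β i * edgeCount (M.G i) * q ^ (edgeCount (M.G i) - 1)) +
          δ / (M.s + 1) <
        d * (M.β i * (copyCount (M.G i) (addEdge X e) / (n : ℝ) ^ ((M.V i : ℤ) - 2)) -
          M.β i * (copyCount (M.G i) (removeEdge X e) / (n : ℝ) ^ ((M.V i : ℤ) - 2)))} ≤
        η / (M.s + 1) := by
    refine eventually_all.2 fun i => h.eventually_prob_copyCount_le hd hq0 hq1 (M.G i) ?_
      (by positivity) (by positivity)
    by_cases hi : i = 0
    · exact .inr (hi ▸ M.edgeCount_first)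
    · exact .inl (M.β_nonneg i hi)
  filter_upwards [h1] with n hn e he
  refine (M.prob_mono ?_).trans ((M.prob_iUnion_le _).trans
    ((Finset.sum_le_sum fun i _ => hn i e he).trans_eq ?_))
  · intro X hX
    by_contra hcon
    simp only [Set.mem_iUnion, Set.mem_ofPred_eq, not_exists, not_lt] at hcon
    have h2 := Finset.sum_le_sum fun i (_ : i ∈ Finset.univ) => hcon i
    rw [← Finset.mul_sum, Finset.sum_sub_distrib, Finset.sum_add_distrib, ← Finset.mul_sum,
      Finset.sum_const, Finset.card_univ, Fintype.card_fin, nsmul_eq_mul] at h2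
    have h3 : ((M.s + 1 : ℕ) : ℝ) * (δ / (M.s + 1)) = δ := by
      push_cast
      field_simp
    rw [h3] at h2
    exact absurd hX (not_lt.2 h2)
  · rw [Finset.sum_const, Finset.card_univ, Fintype.card_fin, nsmul_eq_mul]
    push_cast
    field_simp

/-! ### Fixed points -/

lemma logistic_strictMono : StrictMono fun t : ℝ => Real.exp t / (1 + Real.exp t) := by
  intro a b hab
  have h := Real.exp_lt_exp.2 hab
  have ha := Real.exp_pos a
  have hb := Real.exp_pos b
  rw [div_lt_div_iff₀ (by positivity) (by positivity)]
  nlinarith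

lemma continuous_logistic : Continuous fun t : ℝ => Real.exp t / (1 + Real.exp t) :=
  Real.continuous_exp.div (continuous_const.add Real.continuous_exp) fun t => by positivity

lemma continuous_psi (M : Model) : Continuous M.psi := by
  unfold psi
  fun_prop

lemma continuous_phi (M : Model) : Continuous M.phi := continuous_logistic.comp M.continuous_psi

lemma phi_pos (M : Model) (q : ℝ) : 0 < M.phi q := by unfold phi; positivity

lemma phi_lt_one (M : Model) (q : ℝ) : M.phi q < 1 := by
  unfold phi
  rw [div_lt_one (by positivity)]
  linarith

/-- The edge term of `psi` is constant, so a negative weight on it does no harm. -/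
lemma phi_mono (M : Model) {a b : ℝ} (ha : 0 ≤ a) (hab : a ≤ b) : M.phi a ≤ M.phi b := by
  refine logistic_strictMono.monotone (Finset.sum_le_sum fun i _ => ?_)
  by_cases hi : i = 0
  · subst hi
    simp [M.edgeCount_first]
  · have := M.β_nonneg i hi
    gcongr

/-- The energy gap passes `psi q + d / (k + 1)` in direction `d` only with small probability, so
domination holds at the logistic value of that number; then `k → ∞`. -/
lemma Dominated.phi {M : Model} {d q : ℝ} (h : M.Dominated d q) (hd : d = 1 ∨ d = -1)
    (hq0 : 0 ≤ q) (hq1 : q ≤ 1) : M.Dominated d (M.phi q) := by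
  have h1 : Tendsto (fun k : ℕ => M.psi q + d * (1 / ((k : ℝ) + 1))) atTop (nhds (M.psi q)) := by
    simpa using (tendsto_one_div_add_atTop_nhds_zero_nat.const_mul d).const_add (M.psi q)
  refine Dominated.of_tendsto ((continuous_logistic.tendsto _).comp h1) fun k => ?_
  set t := M.psi q + d * (1 / ((k : ℝ) + 1)) with ht
  have hexp := Real.exp_pos t
  refine M.dominated_of_prob_condProb hd (by simp only [Function.comp]; positivity) ?_
    fun η hη => ?_
  · simp only [Function.comp]
    rw [div_le_one (by positivity)]
    linarith
  · have hk : 0 < 1 / ((k : ℝ) + 1) := by positivity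
    filter_upwards [h.eventually_prob_energyGap_le hd hq0 hq1 hk hη] with n hn e he
    refine (M.prob_mono fun X hX => ?_).trans (hn e he)
    have hX' : d * (Real.exp t / (1 + Real.exp t)) <
      d * (Real.exp (M.energyGap e X) / (1 + Real.exp (M.energyGap e X))) := hX
    change d * M.psi q + 1 / ((k : ℝ) + 1) < d * M.energyGap e X
    rcases hd with rfl | rfl
    · rw [one_mul, one_mul] at hX'
      have := logistic_strictMono.lt_iff_lt.1 hX'
      linarith
    · have := logistic_strictMono.lt_iff_lt.1 (neg_lt_neg_iff.1 (by simpa only [neg_one_mul] using hX'))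
      linarith

/-- The iterates of `phi` decrease from 1 or increase from 0, starting from a trivial domination.
Their limit is a fixed point in [0, 1], hence `p`. -/
lemma HighTemperature.dominated {M : Model} {p : ℝ} (hp : M.HighTemperature p) {d : ℝ}
    (hd : d = 1 ∨ d = -1) : M.Dominated d p := by
  have hmaps : ∀ x, x ∈ Set.Icc (0 : ℝ) 1 → ∀ k, M.phi^[k] x ∈ Set.Icc (0 : ℝ) 1 := by
    intro x hx k
    induction k with
    | zero => exact hx
    | succ k ih =>
      rw [Function.iterate_succ_apply']
      exact ⟨(M.phi_pos _).le, (M.phi_lt_one _).le⟩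
  have hdom : ∀ x, x ∈ Set.Icc (0 : ℝ) 1 → M.Dominated d x → ∀ k, M.Dominated d (M.phi^[k] x) := by
    intro x hx h k
    induction k with
    | zero => exact h
    | succ k ih =>
      rw [Function.iterate_succ_apply']
      exact ih.phi hd (hmaps x hx k).1 (hmaps x hx k).2
  have hlim : ∀ x y, x ∈ Set.Icc (0 : ℝ) 1 → M.Dominated d x →
      Tendsto (fun k => M.phi^[k] x) atTop (nhds y) → M.Dominated d p := by
    intro x y hx h hy
    have hfix := isFixedPt_of_tendsto_iterate hy M.continuous_phi.continuousAt
    have hy' : y ∈ Set.Icc (0 : ℝ) 1 :=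
      isClosed_Icc.mem_of_tendsto hy (Eventually.of_forall (hmaps x hx))
    rw [← hp.unique y hy' hfix]
    exact Dominated.of_tendsto hy (hdom x hx h)
  rcases hd with rfl | rfl
  · have h1 : (1 : ℝ) ∈ Set.Icc (0 : ℝ) 1 := by simp
    have hanti : Antitone fun k => M.phi^[k] 1 := antitone_nat_of_succ_le fun k => by
      induction k with
      | zero => exact (M.phi_lt_one 1).le
      | succ k ih =>
        simp only [Function.iterate_succ_apply'] at ih ⊢
        exact M.phi_mono (M.phi_pos _).le ih
    exact hlim 1 _ h1 M.dominated_one (tendsto_atTop_ciInf hanti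
      ⟨0, Set.forall_mem_range.2 fun k => (hmaps 1 h1 k).1⟩)
  · have h0 : (0 : ℝ) ∈ Set.Icc (0 : ℝ) 1 := by simp
    have hmono : Monotone fun k => M.phi^[k] 0 := monotone_nat_of_le_succ fun k => by
      induction k with
      | zero => exact (M.phi_pos 0).le
      | succ k ih =>
        rw [Function.iterate_succ_apply', Function.iterate_succ_apply' (n := k + 1)]
        exact M.phi_mono (hmaps 0 h0 k).1 ih
    exact hlim 0 _ h0 M.dominated_zero (tendsto_atTop_ciSup hmono
      ⟨1, Set.forall_mem_range.2 fun k => (hmaps 0 h0 k).2⟩)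

lemma HighTemperature.pos {M : Model} {p : ℝ} (hp : M.HighTemperature p) : 0 < p :=
  hp.fixed ▸ M.phi_pos p

lemma HighTemperature.lt_one {M : Model} {p : ℝ} (hp : M.HighTemperature p) : p < 1 :=
  hp.fixed ▸ M.phi_lt_one p

/-- The edges of the exponential random graph in the high temperature phase are asymptotically
independent. -/
lemma HighTemperature.eventually_expect_edgesInd {M : Model} {p : ℝ} (hp : M.HighTemperature p)
    (k : ℕ) {ε : ℝ} (hε : 0 < ε) :
    ∀ᶠ n : ℕ in atTop, ∀ F : Finset (Sym2 (Fin n)), F.card = k → (∀ e ∈ F, ¬ e.IsDiag) →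
      |M.expect (edgesInd F) - p ^ k| ≤ ε := by
  -- Lists with a single member suffice here: `d = 1` gives the upper bound and `d = -1` the lower
  -- one.
  filter_upwards [hp.dominated (.inl rfl) k 1 ε hε, hp.dominated (.inr rfl) k 1 ε hε]
    with n h1 h2 F hF hdiag
  have hL : IsEdgeFamily k 1 [F] := ⟨rfl, List.pairwise_singleton _ _, by simpa using hF,
    by simpa using hdiag⟩
  have hs : ∀ d, M.expect (sideProd d [F]) = (1 - d) / 2 + d * M.expect (edgesInd F) := by
    intro d
    rw [← expect_const_mul, ← M.expect_const (n := n) ((1 - d) / 2), ← expect_add]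
    congr 1
    ext X
    simp [sideProd, side]
  have h1' := h1 _ hL
  have h2' := h2 _ hL
  rw [hs, side, pow_one] at h1' h2'
  rw [abs_le]
  constructor <;> linarith

end Model

/-! ### Homomorphism densities -/

section HomDensity

variable {V : Type*} {n : ℕ}

lemma prod_edgeInd_nonneg (E : Finset (Sym2 V)) (X : SimpleGraph (Fin n)) (φ : V → Fin n) :
    0 ≤ ∏ e ∈ E, edgeInd X (e.map φ) := Finset.prod_nonneg fun _ _ => edgeInd_nonneg X _

lemma prod_edgeInd_le_one (E : Finset (Sym2 V)) (X : SimpleGraph (Fin n)) (φ : V → Fin n) :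
    ∏ e ∈ E, edgeInd X (e.map φ) ≤ 1 :=
  Finset.prod_le_one (fun _ _ => edgeInd_nonneg X _) fun _ _ => edgeInd_le_one X _

lemma prod_edgeInd_eq_edgesInd (E : Finset (Sym2 V)) (X : SimpleGraph (Fin n)) {φ : V → Fin n}
    (hφ : Function.Injective φ) :
    ∏ e ∈ E, edgeInd X (e.map φ) = edgesInd (E.image (Sym2.map φ)) X := by
  rw [edgesInd, Finset.prod_image fun a _ b _ h => Sym2.map.injective hφ h]

variable [DecidableEq V]

/-- Two disjoint copies of a set of pairs. -/
def doublePairs (E : Finset (Sym2 V)) : Finset (Sym2 (V ⊕ V)) :=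
  E.image (Sym2.map Sum.inl) ∪ E.image (Sym2.map Sum.inr)

lemma disjoint_doublePairs (E : Finset (Sym2 V)) :
    Disjoint (E.image (Sym2.map (Sum.inl : V → V ⊕ V)))
      (E.image (Sym2.map (Sum.inr : V → V ⊕ V))) := by
  rw [Finset.disjoint_left]
  intro f hf hf'
  obtain ⟨a, -, rfl⟩ := Finset.mem_image.1 hf
  obtain ⟨b, -, hb⟩ := Finset.mem_image.1 hf'
  induction a using Sym2.ind with
  | _ x y =>
  induction b using Sym2.ind with
  | _ z w => simp [Sym2.map_mk] at hb

lemma card_doublePairs (E : Finset (Sym2 V)) : (doublePairs E).card = 2 * E.card := by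
  rw [doublePairs, Finset.card_union_of_disjoint (disjoint_doublePairs E),
    Finset.card_image_of_injective _ (Sym2.map.injective Sum.inl_injective),
    Finset.card_image_of_injective _ (Sym2.map.injective Sum.inr_injective), two_mul]

lemma not_isDiag_of_mem_doublePairs {E : Finset (Sym2 V)} (hE : ∀ e ∈ E, ¬ e.IsDiag)
    {e : Sym2 (V ⊕ V)} (he : e ∈ doublePairs E) : ¬ e.IsDiag := by
  rcases Finset.mem_union.1 he with h | h
  · obtain ⟨a, ha, rfl⟩ := Finset.mem_image.1 h
    rw [Sym2.isDiag_map Sum.inl_injective]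
    exact hE a ha
  · obtain ⟨a, ha, rfl⟩ := Finset.mem_image.1 h
    rw [Sym2.isDiag_map Sum.inr_injective]
    exact hE a ha

variable [Fintype V]

/-- The proportion of the maps `V → Fin n` that map all pairs in `E` to edges of `X`. -/
def homDensity (E : Finset (Sym2 V)) (X : SimpleGraph (Fin n)) : ℝ :=
  (∑ φ : V → Fin n, ∏ e ∈ E, edgeInd X (e.map φ)) / (n : ℝ) ^ Fintype.card V

lemma homDensity_nonneg (E : Finset (Sym2 V)) (X : SimpleGraph (Fin n)) : 0 ≤ homDensity E X :=
  div_nonneg (Finset.sum_nonneg fun φ _ => prod_edgeInd_nonneg E X φ) (by positivity)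

lemma homDensity_le_one (E : Finset (Sym2 V)) (X : SimpleGraph (Fin n)) : homDensity E X ≤ 1 := by
  refine div_le_one_of_le₀ ?_ (by positivity)
  refine (Finset.sum_le_sum fun φ _ => prod_edgeInd_le_one E X φ).trans_eq ?_
  simp

open Classical in
lemma tendsto_card_not_injective (V : Type*) [Fintype V] [DecidableEq V] :
    Tendsto (fun n : ℕ => ((Finset.univ.filter fun φ : V → Fin n =>
      ¬ Function.Injective φ).card : ℝ) / (n : ℝ) ^ Fintype.card V) atTop (nhds 0) := by
  have h := (tendsto_descFactorial_div_pow (Fintype.card V)).const_sub 1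
  rw [sub_self] at h
  refine h.congr' ?_
  filter_upwards [eventually_gt_atTop 0] with n hn
  have h1 := Finset.card_filter_add_card_filter_not (s := Finset.univ)
    (fun φ : V → Fin n => Function.Injective φ)
  rw [card_filter_injective, Finset.card_univ, Fintype.card_fun, Fintype.card_fin] at h1
  have h2 := congrArg (Nat.cast : ℕ → ℝ) h1
  push_cast at h2
  have h3 : (n : ℝ) ^ Fintype.card V ≠ 0 := by positivity
  rw [eq_div_iff h3, sub_mul, div_mul_cancel₀ _ h3]
  linarith

/-- Pairs of maps from `V` are maps from `V ⊕ V`. Second moments are thereby first moments for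
another pattern. -/
lemma homDensity_sq (E : Finset (Sym2 V)) (X : SimpleGraph (Fin n)) :
    homDensity E X ^ 2 = homDensity (doublePairs E) X := by
  rw [homDensity, homDensity, div_pow, Fintype.card_sum, pow_add, ← sq, sq, sq,
    Finset.sum_mul_sum, ← Fintype.sum_prod_type',
    ← Fintype.sum_equiv (Equiv.sumArrowEquivProdArrow V V (Fin n)) _ _ fun _ => rfl]
  congr 1
  refine Finset.sum_congr rfl fun φ _ => ?_
  rw [doublePairs, Finset.prod_union (disjoint_doublePairs E),
    Finset.prod_image fun a _ b _ h => Sym2.map.injective Sum.inl_injective h,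
    Finset.prod_image fun a _ b _ h => Sym2.map.injective Sum.inr_injective h]
  simp only [Sym2.map_map]
  rfl

end HomDensity

namespace Model

variable {M : Model} {p : ℝ} {V : Type*} [Fintype V] [DecidableEq V]

/-- Each injective map contributes nearly `p ^ E.card`, uniformly, and the non-injective maps form a
vanishing proportion. -/
lemma HighTemperature.tendsto_expect_homDensity (hp : M.HighTemperature p)
    (E : Finset (Sym2 V)) (hE : ∀ e ∈ E, ¬ e.IsDiag) :
    Tendsto (fun n : ℕ => M.expect (n := n) (homDensity E)) atTop (nhds (p ^ E.card)) := by
  classical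
  rw [Metric.tendsto_nhds]
  intro ε hε
  filter_upwards [hp.eventually_expect_edgesInd E.card (half_pos hε),
    (tendsto_card_not_injective V).eventually (gt_mem_nhds (half_pos hε)),
    eventually_gt_atTop 0] with n hn hn2 hn0
  have hpow : 0 < (n : ℝ) ^ Fintype.card V := by positivity
  rw [div_lt_iff₀ hpow] at hn2
  have h0 : 0 ≤ p ^ E.card := pow_nonneg hp.pos.le _
  have h1 : p ^ E.card ≤ 1 := pow_le_one₀ hp.pos.le hp.lt_one.le
  have hterm : ∀ φ : V → Fin n,
      |M.expect (fun X => ∏ e ∈ E, edgeInd X (e.map φ)) - p ^ E.card| ≤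
        ε / 2 + if ¬ Function.Injective φ then 1 else 0 := by
    intro φ
    by_cases hφ : Function.Injective φ
    · simp only [hφ, not_true_eq_false, if_false, add_zero, prod_edgeInd_eq_edgesInd E _ hφ]
      refine hn _ (Finset.card_image_of_injective _ (Sym2.map.injective hφ)) fun f hf => ?_
      obtain ⟨e, he, rfl⟩ := Finset.mem_image.1 hf
      rw [Sym2.isDiag_map hφ]
      exact hE e he
    · simp only [hφ, not_false_eq_true, if_true]
      have h2 := M.expect_nonneg fun X => prod_edgeInd_nonneg E X φ
      have h3 := (M.expect_mono fun X => prod_edgeInd_le_one E X φ).trans_eq (M.expect_const 1)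
      rw [abs_le]
      constructor <;> linarith
  have hdiff : M.expect (n := n) (homDensity E) - p ^ E.card =
      (∑ φ : V → Fin n, (M.expect (fun X => ∏ e ∈ E, edgeInd X (e.map φ)) - p ^ E.card)) /
        (n : ℝ) ^ Fintype.card V := by
    rw [Finset.sum_sub_distrib, ← expect_sum, sub_div, Finset.sum_const, Finset.card_univ,
      Fintype.card_fun, Fintype.card_fin, nsmul_eq_mul]
    push_cast
    rw [mul_div_cancel_left₀ _ hpow.ne', div_eq_mul_inv, ← expect_mul_const]
    rfl
  rw [Real.dist_eq, hdiff, abs_div, abs_of_pos hpow, div_lt_iff₀ hpow]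
  calc _ ≤ ∑ φ : V → Fin n, (ε / 2 + if ¬ Function.Injective φ then (1 : ℝ) else 0) :=
        (Finset.abs_sum_le_sum_abs _ _).trans (Finset.sum_le_sum fun φ _ => hterm φ)
    _ < _ := by
        rw [Finset.sum_add_distrib, Finset.sum_const, Finset.sum_boole, Finset.card_univ,
          Fintype.card_fun, Fintype.card_fin, nsmul_eq_mul]
        push_cast
        linarith

lemma HighTemperature.tendsto_expect_homDensity_sub_sq (hp : M.HighTemperature p)
    (E : Finset (Sym2 V)) (hE : ∀ e ∈ E, ¬ e.IsDiag) :
    Tendsto (fun n : ℕ => M.expect (n := n) fun X => (homDensity E X - p ^ E.card) ^ 2) atTop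
      (nhds 0) := by
  have h1 := hp.tendsto_expect_homDensity E hE
  have h2 := hp.tendsto_expect_homDensity (doublePairs E) fun e he =>
    not_isDiag_of_mem_doublePairs hE he
  rw [card_doublePairs] at h2
  have h3 := (h2.sub (h1.const_mul (2 * p ^ E.card))).add_const ((p ^ E.card) ^ 2)
  have h4 : p ^ (2 * E.card) - 2 * p ^ E.card * p ^ E.card + (p ^ E.card) ^ 2 = 0 := by ring
  rw [h4] at h3
  refine h3.congr fun n => ?_
  have h5 : ∀ X : SimpleGraph (Fin n), (homDensity E X - p ^ E.card) ^ 2 =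
      homDensity (doublePairs E) X - 2 * p ^ E.card * homDensity E X + (p ^ E.card) ^ 2 :=
    fun X => by
      rw [← homDensity_sq]
      ring
  simp only [h5, expect_add, expect_sub, expect_const_mul, expect_const]

/-! ### Typical graphs -/

/-- The finite sets of pairs of different elements of some `Fin l`. -/
abbrev _root_.ERG.Pattern : Type :=
  Σ l : ℕ, {E : Finset (Sym2 (Fin l)) // ∀ e ∈ E, ¬ e.IsDiag}

instance : Encodable Pattern := Encodable.ofCountable _

/-- A weighted sum of the squared deviations of all homomorphism densities from those of a random
graph of density `p`. -/
def _root_.ERG.deviation (p : ℝ) {n : ℕ} (X : SimpleGraph (Fin n)) : ℝ :=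
  ∑' P : Pattern, (1 / 2) ^ Encodable.encode P * (homDensity P.2.1 X - p ^ P.2.1.card) ^ 2

lemma HighTemperature.deviation_term_le (hp : M.HighTemperature p) {n : ℕ}
    (X : SimpleGraph (Fin n)) (P : Pattern) :
    (1 / 2) ^ Encodable.encode P * (homDensity P.2.1 X - p ^ P.2.1.card) ^ 2 ≤
      (1 / 2 : ℝ) ^ Encodable.encode P := by
  refine mul_le_of_le_one_right (by positivity) ?_
  have h0 : 0 ≤ p ^ P.2.1.card := pow_nonneg hp.pos.le _
  have h1 : p ^ P.2.1.card ≤ 1 := pow_le_one₀ hp.pos.le hp.lt_one.le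
  rw [sq_le_one_iff_abs_le_one, abs_le]
  constructor <;> linarith [homDensity_nonneg P.2.1 X, homDensity_le_one P.2.1 X]

lemma HighTemperature.summable_deviation (hp : M.HighTemperature p) {n : ℕ}
    (X : SimpleGraph (Fin n)) : Summable fun P : Pattern =>
      (1 / 2 : ℝ) ^ Encodable.encode P * (homDensity P.2.1 X - p ^ P.2.1.card) ^ 2 :=
  Summable.of_nonneg_of_le (fun P => by positivity) (hp.deviation_term_le X)
    summable_geometric_two_encode

/-- Dominated convergence for the series: each term tends to 0 and is bounded by its geometric
weight. -/
lemma HighTemperature.tendsto_expect_deviation (hp : M.HighTemperature p) :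
    Tendsto (fun n : ℕ => M.expect (n := n) (deviation p)) atTop (nhds 0) := by
  have h := tendsto_tsum_of_dominated_convergence (𝓕 := atTop)
    (f := fun (n : ℕ) (P : Pattern) => M.expect (n := n) fun X =>
      (1 / 2 : ℝ) ^ Encodable.encode P * (homDensity P.2.1 X - p ^ P.2.1.card) ^ 2)
    (g := fun _ => 0) (summable_geometric_two_encode (ι := Pattern)) (fun P => ?_)
    (Eventually.of_forall fun n P => ?_)
  · rw [tsum_zero] at h
    refine h.congr fun n => ?_
    simp only [expect, deviation]
    rw [Summable.tsum_finsetSum fun X _ => (hp.summable_deviation X).mul_left _]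
    simp only [tsum_mul_left]
  · simp only [expect_const_mul]
    simpa using (hp.tendsto_expect_homDensity_sub_sq P.2.1 P.2.2).const_mul
      ((1 / 2 : ℝ) ^ Encodable.encode P)
  · rw [Real.norm_of_nonneg (M.expect_nonneg fun X => by positivity)]
    exact (M.expect_mono fun X => hp.deviation_term_le X P).trans_eq (M.expect_const _)

/-- Almost all graphs have asymptotically the homomorphism densities of a random graph of
density `p`. -/
lemma HighTemperature.exists_typical (hp : M.HighTemperature p) :
    ∃ S : (n : ℕ) → Set (SimpleGraph (Fin n)),
      Tendsto (fun n : ℕ => M.prob (S n)) atTop (nhds 1) ∧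
      ∀ X : (n : ℕ) → SimpleGraph (Fin n), (∀ᶠ n in atTop, X n ∈ S n) →
        ∀ (l : ℕ) (E : Finset (Sym2 (Fin l))), (∀ e ∈ E, ¬ e.IsDiag) →
          Tendsto (fun n => homDensity E (X n)) atTop (nhds (p ^ E.card)) := by
  have hdev0 : ∀ {n : ℕ} (X : SimpleGraph (Fin n)), 0 ≤ deviation p X := fun X =>
    tsum_nonneg fun P => by positivity
  -- The threshold tends to 0, but so slowly that the mean deviation divided by it is still at most
  -- `w n`; the summand `1 / (n + 1)` keeps it positive.
  set w : ℕ → ℝ := fun n => Real.sqrt (M.expect (n := n) (deviation p) + 1 / ((n : ℝ) + 1)) with hw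
  have hw0 : Tendsto w atTop (nhds 0) := by
    have h := (hp.tendsto_expect_deviation.add tendsto_one_div_add_atTop_nhds_zero_nat).sqrt
    rwa [add_zero, Real.sqrt_zero] at h
  have hwpos : ∀ n, 0 < w n := fun n => Real.sqrt_pos.2
    (add_pos_of_nonneg_of_pos (M.expect_nonneg hdev0) (by positivity))
  refine ⟨fun n => {X | w n < deviation p X}ᶜ, ?_, fun X hX l E hE => ?_⟩
  · simp only [prob_compl]
    have h1 : Tendsto (fun n : ℕ => M.prob {X : SimpleGraph (Fin n) | w n < deviation p X}) atTop
        (nhds 0) := by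
      refine squeeze_zero (fun n => M.prob_nonneg _) (fun n => ?_) hw0
      refine le_of_mul_le_mul_left ((M.mul_prob_le_expect hdev0 (w n)).trans ?_) (hwpos n)
      rw [hw, Real.mul_self_sqrt (add_nonneg (M.expect_nonneg hdev0) (by positivity))]
      have : 0 ≤ 1 / ((n : ℝ) + 1) := by positivity
      linarith
    simpa using h1.const_sub 1
  · set P : Pattern := ⟨l, E, hE⟩ with hP
    set c : ℝ := (1 / 2) ^ Encodable.encode P with hc
    have hcpos : 0 < c := by positivity
    have h1 : Tendsto (fun n => (homDensity E (X n) - p ^ E.card) ^ 2) atTop (nhds 0) := by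
      have h2 : Tendsto (fun n => w n / c) atTop (nhds 0) := by simpa using hw0.div_const c
      refine squeeze_zero' (Eventually.of_forall fun n => sq_nonneg _) ?_ h2
      filter_upwards [hX] with n hn
      rw [le_div_iff₀ hcpos, mul_comm]
      have hn' : deviation p (X n) ≤ w n := not_lt.1 hn
      exact ((hp.summable_deviation (X n)).le_tsum P fun Q _ => by positivity).trans hn'
    have h2 : Tendsto (fun n => |homDensity E (X n) - p ^ E.card|) atTop (nhds 0) := by
      simpa [Real.sqrt_sq_eq_abs] using h1.sqrt
    exact tendsto_sub_nhds_zero_iff.1 ((tendsto_zero_iff_abs_tendsto_zero _).2 h2)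

end Model

/-! ### Closed walks of length four -/

/-- The sum of `f x y * f y z * f z w * f w x` over all `x, y, z, w`. -/
def fourCycleSum {n : ℕ} (f : Fin n → Fin n → ℝ) : ℝ :=
  ∑ x, ∑ y, ∑ z, ∑ w, f x y * f y z * f z w * f w x

/-- Cauchy–Schwarz twice, first over `x` and then over pairs `(y, z)`; the sum of the squared
codegrees `h y z` is the closed 4-walk sum. -/
lemma sum_sum_pow_four_le {n : ℕ} {f : Fin n → Fin n → ℝ} (hf : ∀ x y, f x y = f y x)
    (U : Finset (Fin n)) :
    (∑ x ∈ U, ∑ y ∈ U, f x y) ^ 4 ≤ (n : ℝ) ^ 4 * fourCycleSum f := by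
  set h : Fin n → Fin n → ℝ := fun y z => ∑ x, f x y * f x z with hh
  have hU : (U.card : ℝ) ≤ n := by
    exact_mod_cast (Finset.card_le_univ U).trans_eq (Fintype.card_fin n)
  have h1 : (∑ x ∈ U, ∑ y ∈ U, f x y) ^ 2 ≤ n * ∑ y ∈ U, ∑ z ∈ U, h y z := by
    calc _ ≤ U.card * ∑ x ∈ U, (∑ y ∈ U, f x y) ^ 2 := sq_sum_le_card_mul_sum_sq
      _ ≤ n * ∑ x, (∑ y ∈ U, f x y) ^ 2 := by
        refine mul_le_mul hU (Finset.sum_le_univ_sum_of_nonneg fun x => sq_nonneg _)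
          (Finset.sum_nonneg fun x _ => sq_nonneg _) (Nat.cast_nonneg n)
      _ = _ := by
        congr 1
        simp only [hh, sq, Finset.sum_mul_sum]
        rw [Finset.sum_comm]
        exact Finset.sum_congr rfl fun y _ => Finset.sum_comm
  have h2 : (∑ y ∈ U, ∑ z ∈ U, h y z) ^ 2 ≤ (n : ℝ) ^ 2 * ∑ y, ∑ z, h y z ^ 2 := by
    rw [← Finset.sum_product' U U h, ← Fintype.sum_prod_type' fun y z => h y z ^ 2]
    calc (∑ x ∈ U ×ˢ U, h x.1 x.2) ^ 2
        ≤ ((U ×ˢ U).card : ℝ) * ∑ x ∈ U ×ˢ U, h x.1 x.2 ^ 2 := sq_sum_le_card_mul_sum_sq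
      _ ≤ _ := by
        refine mul_le_mul ?_ (Finset.sum_le_univ_sum_of_nonneg fun x => sq_nonneg _)
          (Finset.sum_nonneg fun x _ => sq_nonneg _) (by positivity)
        rw [Finset.card_product, Nat.cast_mul, sq]
        gcongr
  have h3 : ∑ y, ∑ z, h y z ^ 2 = fourCycleSum f := by
    simp only [hh, sq, Finset.sum_mul_sum, fourCycleSum]
    calc _ = ∑ y, ∑ x, ∑ z, ∑ w, f x y * f x z * (f w y * f w z) := by
          refine Finset.sum_congr rfl fun y _ => ?_
          rw [Finset.sum_comm]
      _ = ∑ y, ∑ x, ∑ z, ∑ w, f y x * f x z * f z w * f w y := by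
          refine Finset.sum_congr rfl fun y _ => Finset.sum_congr rfl fun x _ =>
            Finset.sum_congr rfl fun z _ => Finset.sum_congr rfl fun w _ => ?_
          rw [hf x y, hf w z]
          ring
  calc (∑ x ∈ U, ∑ y ∈ U, f x y) ^ 4 = ((∑ x ∈ U, ∑ y ∈ U, f x y) ^ 2) ^ 2 := by ring
    _ ≤ (n * ∑ y ∈ U, ∑ z ∈ U, h y z) ^ 2 := pow_le_pow_left₀ (sq_nonneg _) h1 2
    _ = (n : ℝ) ^ 2 * (∑ y ∈ U, ∑ z ∈ U, h y z) ^ 2 := by ring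
    _ ≤ (n : ℝ) ^ 2 * ((n : ℝ) ^ 2 * ∑ y, ∑ z, h y z ^ 2) := by gcongr
    _ = _ := by rw [h3]; ring

lemma fourCycleSum_nonneg {n : ℕ} {f : Fin n → Fin n → ℝ} (hf : ∀ x y, f x y = f y x) :
    0 ≤ fourCycleSum f := by
  rcases Nat.eq_zero_or_pos n with rfl | hn
  · simp [fourCycleSum]
  · have h := (Even.pow_nonneg (by decide : Even 4) _).trans (sum_sum_pow_four_le hf Finset.univ)
    exact nonneg_of_mul_nonneg_right h (by positivity)

lemma trace_pow_four {n : ℕ} (A : Matrix (Fin n) (Fin n) ℝ) :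
    (A ^ 4).trace = fourCycleSum A := by
  have : A ^ 4 = A * (A * (A * A)) := by simp only [pow_succ, pow_zero, one_mul, mul_assoc]
  simp only [this, Matrix.trace, Matrix.diag_apply, Matrix.mul_apply, fourCycleSum, Finset.mul_sum]
  refine Finset.sum_congr rfl fun x _ => Finset.sum_congr rfl fun y _ =>
    Finset.sum_congr rfl fun z _ => Finset.sum_congr rfl fun w _ => by ring

/-! ### Eigenvalues -/

section Eigenvalues

variable {n : ℕ} {A : Matrix (Fin n) (Fin n) ℝ}

lemma sum_eigenvalues_pow_four (hA : A.IsHermitian) :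
    ∑ i, hA.eigenvalues i ^ 4 = fourCycleSum A := by
  rw [← trace_pow_four]
  conv_rhs => rw [hA.spectral_theorem, ← map_pow, Unitary.conjStarAlgAut_apply,
    Matrix.trace_mul_comm, ← mul_assoc, Unitary.coe_star_mul_self, one_mul, Matrix.diagonal_pow,
    Matrix.trace_diagonal]
  simp

/-- The Rayleigh quotient of the all-ones vector is at least `m`, and it is a weighted mean of the
eigenvalues. -/
lemma exists_le_eigenvalues (hA : A.IsHermitian) {m : ℝ} (hn : 0 < n)
    (hm : m * n ≤ ∑ x, ∑ y, A x y) : ∃ i, m ≤ hA.eigenvalues i := by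
  by_contra! hcon
  set U : Matrix (Fin n) (Fin n) ℝ :=
    (hA.eigenvectorUnitary : Matrix (Fin n) (Fin n) ℝ) with hU
  -- Coordinates of the all-ones vector in the eigenbasis.
  set v : Fin n → ℝ := Matrix.mulVec (star U) 1 with hv
  have hv' : Matrix.vecMul 1 U = v := by
    rw [hv, Matrix.star_eq_conjTranspose, Matrix.conjTranspose_eq_transpose_of_trivial,
      Matrix.mulVec_transpose]
  have hUU : U * star U = 1 := Unitary.coe_mul_star_self _
  have h1 : ∑ x, ∑ y, A x y = ∑ i, hA.eigenvalues i * v i ^ 2 := by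
    have h2 : ∑ x, ∑ y, A x y = dotProduct 1 (A.mulVec 1) := by
      simp [dotProduct, Matrix.mulVec]
    rw [h2]
    conv_lhs => rw [hA.spectral_theorem, Unitary.conjStarAlgAut_apply]
    rw [← Matrix.mulVec_mulVec, ← Matrix.mulVec_mulVec, Matrix.dotProduct_mulVec]
    change dotProduct (Matrix.vecMul 1 U) (Matrix.mulVec _ v) = _
    rw [hv']
    simp only [dotProduct, Matrix.mulVec_diagonal, Function.comp_apply, RCLike.ofReal_real_eq_id,
      id_eq]
    exact Finset.sum_congr rfl fun i _ => by ring
  have h3 : ∑ i, v i ^ 2 = n := by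
    have h4 : dotProduct v v = n := by
      nth_rewrite 1 [← hv']
      rw [hv, ← Matrix.dotProduct_mulVec, Matrix.mulVec_mulVec, hUU, Matrix.one_mulVec]
      simp [dotProduct]
    rw [← h4]
    exact Finset.sum_congr rfl fun i _ => sq _
  have h5 : ∃ i, 0 < v i ^ 2 := by
    by_contra! h
    have : ∑ i, v i ^ 2 ≤ 0 := Finset.sum_nonpos fun i _ => h i
    rw [h3] at this
    have : (0 : ℝ) < n := by exact_mod_cast hn
    linarith
  obtain ⟨i, hi⟩ := h5
  have h6 : ∑ i, hA.eigenvalues i * v i ^ 2 < ∑ i, m * v i ^ 2 :=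
    Finset.sum_lt_sum (fun j _ => mul_le_mul_of_nonneg_right (hcon j).le (sq_nonneg _))
      ⟨i, Finset.mem_univ i, mul_lt_mul_of_pos_right (hcon i) hi⟩
  rw [← Finset.mul_sum, h3, ← h1] at h6
  linarith

end Eigenvalues

open Classical in
-- Some eigenvalue is at least `m`. If it were not the one listed first, two eigenvalues would have
-- absolute value at least `m` and the fourth powers would sum to at least `2 * m ^ 4`. This
-- excludes a negative leading eigenvalue.
lemma adjEigenvalue_bounds {n : ℕ} (hn : 2 ≤ n) (X : SimpleGraph (Fin n)) {m : ℝ} (hm : 0 < m)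
    (h1 : m * n ≤ ∑ x, ∑ y, X.adjMatrix ℝ x y)
    (h2 : fourCycleSum (X.adjMatrix ℝ) < 2 * m ^ 4) :
    m ≤ adjEigenvalue X 0 ∧
      adjEigenvalue X 0 ^ 4 + adjEigenvalue X 1 ^ 4 ≤ fourCycleSum (X.adjMatrix ℝ) := by
  set hA := X.isHermitian_adjMatrix (R := ℝ)
  set ev : Fin n → ℝ := hA.eigenvalues with hev
  set σ := Tuple.sort fun i => -|ev i| with hσ
  have hmono : Monotone ((fun i => -|ev i|) ∘ σ) := Tuple.monotone_sort _
  have hsum : ∑ i, ev i ^ 4 = fourCycleSum (X.adjMatrix ℝ) := sum_eigenvalues_pow_four hA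
  have hpair : ∀ i j, i ≠ j → ev i ^ 4 + ev j ^ 4 ≤ fourCycleSum (X.adjMatrix ℝ) := by
    intro i j hij
    rw [← hsum, ← Finset.sum_pair (f := fun i => ev i ^ 4) hij]
    exact Finset.sum_le_univ_sum_of_nonneg fun i => Even.pow_nonneg (by decide) _
  have e0 : adjEigenvalue X 0 = ev (σ ⟨0, by omega⟩) := by
    rw [adjEigenvalue]
    exact dif_pos (by omega)
  have e1 : adjEigenvalue X 1 = ev (σ ⟨1, by omega⟩) := by
    rw [adjEigenvalue]
    exact dif_pos (by omega)
  rw [e0, e1]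
  refine ⟨?_, hpair _ _ fun h => by simpa using σ.injective h⟩
  obtain ⟨i, hi⟩ := exists_le_eigenvalues hA (by omega) h1
  by_cases hi0 : i = σ ⟨0, by omega⟩
  · rw [← hi0]
    exact hi
  · exfalso
    have h3 : m ≤ |ev (σ ⟨0, by omega⟩)| := by
      have h4 := hmono (Fin.mk_le_of_le_val (Nat.zero_le (σ.symm i).1) : ⟨0, by omega⟩ ≤ σ.symm i)
      simp only [Function.comp_apply, Equiv.apply_symm_apply, neg_le_neg_iff] at h4
      exact (hi.trans (le_abs_self _)).trans h4
    have h5 := hpair _ _ hi0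
    have h6 : m ^ 4 ≤ ev i ^ 4 := pow_le_pow_left₀ hm.le hi 4
    have h7 : m ^ 4 ≤ ev (σ ⟨0, by omega⟩) ^ 4 := by
      rw [← Even.pow_abs (by decide : Even 4) (ev (σ ⟨0, by omega⟩))]
      exact pow_le_pow_left₀ hm.le h3 4
    linarith

/-! ### Quasi-randomness of graphs with the right homomorphism densities -/

/-- All homomorphism densities of the graphs `X n` converge to those of a random graph of
density `p`. -/
def Typical (p : ℝ) (X : (n : ℕ) → SimpleGraph (Fin n)) : Prop :=
  ∀ (l : ℕ) (E : Finset (Sym2 (Fin l))), (∀ e ∈ E, ¬ e.IsDiag) →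
    Tendsto (fun n => homDensity E (X n)) atTop (nhds (p ^ E.card))

/-- Expanding the product gives a linear combination of homomorphism densities of subsets of `E`.
Affine factors cover edges, non-edges (`1 - t`) and centred indicators (`t - p`). -/
lemma Typical.tendsto_sum_prod {p : ℝ} {X : (n : ℕ) → SimpleGraph (Fin n)} (h : Typical p X)
    {l : ℕ} (E : Finset (Sym2 (Fin l))) (hE : ∀ e ∈ E, ¬ e.IsDiag) (a b : Sym2 (Fin l) → ℝ) :
    Tendsto (fun n : ℕ => (∑ φ : Fin l → Fin n, ∏ e ∈ E, (a e * edgeInd (X n) (e.map φ) + b e)) /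
      (n : ℝ) ^ l) atTop (nhds (∏ e ∈ E, (a e * p + b e))) := by
  have h1 : ∀ n : ℕ, (∑ φ : Fin l → Fin n, ∏ e ∈ E, (a e * edgeInd (X n) (e.map φ) + b e)) /
      (n : ℝ) ^ l =
      ∑ t ∈ E.powerset, (∏ e ∈ t, a e) * (∏ e ∈ E \ t, b e) * homDensity t (X n) := by
    intro n
    simp only [Finset.prod_add, Finset.prod_mul_distrib, homDensity, Fintype.card_fin]
    rw [Finset.sum_comm, Finset.sum_div]
    refine Finset.sum_congr rfl fun t _ => ?_
    rw [← mul_div_assoc, Finset.mul_sum]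
    congr 1
    exact Finset.sum_congr rfl fun φ _ => by ring
  have h2 : ∏ e ∈ E, (a e * p + b e) =
      ∑ t ∈ E.powerset, (∏ e ∈ t, a e) * (∏ e ∈ E \ t, b e) * p ^ t.card := by
    simp only [Finset.prod_add, Finset.prod_mul_distrib, Finset.prod_const]
    exact Finset.sum_congr rfl fun t _ => by ring
  simp only [h1, h2]
  exact tendsto_finsetSum _ fun t ht =>
    (h l t fun e he => hE e (Finset.mem_powerset.1 ht he)).const_mul _

/-! ### Counts as sums of products of edge indicators -/

section Counts

variable {n : ℕ} (X : SimpleGraph (Fin n))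

open Classical in
lemma edgeInd_mk_eq_adjMatrix (x y : Fin n) : edgeInd X s(x, y) = X.adjMatrix ℝ x y := by
  rw [SimpleGraph.adjMatrix_apply, edgeInd, Set.indicator_apply]
  rfl

open Classical in
lemma sum_adj_eq_two_mul_edgeCount {V : Type*} [Fintype V] (G : SimpleGraph V) :
    ∑ x, ∑ y, (if G.Adj x y then (1 : ℝ) else 0) = 2 * edgeCount G := by
  have h := congrArg (Nat.cast : ℕ → ℝ) G.sum_degrees_eq_twice_card_edges
  push_cast at h
  rw [← card_edgeFinset_eq_edgeCount, ← h]
  exact Finset.sum_congr rfl fun x _ => (SimpleGraph.degree_eq_sum_if_adj G x).symm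

lemma sum_edgeInd_eq : ∑ x, ∑ y, edgeInd X s(x, y) = 2 * edgeCount X := by
  classical
  rw [← sum_adj_eq_two_mul_edgeCount]
  simp only [edgeInd_mk_eq_adjMatrix, SimpleGraph.adjMatrix_apply]

lemma sum_edgeInd_finset_eq (U : Finset (Fin n)) :
    ∑ x ∈ U, ∑ y ∈ U, edgeInd X s(x, y) = 2 * edgeCount (X.induce (U : Set (Fin n))) := by
  classical
  rw [← sum_adj_eq_two_mul_edgeCount]
  simp only [SimpleGraph.comap_adj, Function.Embedding.subtype_apply]
  rw [Finset.sum_set_coe (U : Set (Fin n)) (f := fun x : Fin n =>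
    ∑ y : (U : Set (Fin n)), if X.Adj x y then (1 : ℝ) else 0), Finset.toFinset_coe]
  refine Finset.sum_congr rfl fun x _ => ?_
  rw [Finset.sum_set_coe (U : Set (Fin n)) (f := fun y : Fin n => if X.Adj x y then (1 : ℝ) else 0),
    Finset.toFinset_coe]
  simp only [edgeInd_mk_eq_adjMatrix, SimpleGraph.adjMatrix_apply]

/-- The pairs of cyclically consecutive elements of `Fin 4`. -/
def fourCycle : Finset (Sym2 (Fin 4)) := {s(0, 1), s(1, 2), s(2, 3), s(3, 0)}

lemma sum_prod_fourCycle (a b : ℝ) :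
    ∑ φ : Fin 4 → Fin n, ∏ e ∈ fourCycle, (a * edgeInd X (e.map φ) + b) =
      fourCycleSum fun x y => a * edgeInd X s(x, y) + b := by
  have h1 : ∀ φ : Fin 4 → Fin n, ∏ e ∈ fourCycle, (a * edgeInd X (e.map φ) + b) =
      (a * edgeInd X s(φ 0, φ 1) + b) * (a * edgeInd X s(φ 1, φ 2) + b) *
        (a * edgeInd X s(φ 2, φ 3) + b) * (a * edgeInd X s(φ 3, φ 0) + b) := by
    intro φ
    rw [fourCycle, Finset.prod_insert (by decide), Finset.prod_insert (by decide),
      Finset.prod_insert (by decide), Finset.prod_singleton]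
    simp only [Sym2.map_mk]
    ring
  simp only [h1]
  let equiv : (Fin 4 → Fin n) ≃ Fin n × Fin n × Fin n × Fin n :=
    { toFun := fun φ => (φ 0, φ 1, φ 2, φ 3)
      invFun := fun t => ![t.1, t.2.1, t.2.2.1, t.2.2.2]
      left_inv := fun φ => by
        ext i
        fin_cases i <;> rfl
      right_inv := fun _ => rfl }
  refine (Fintype.sum_equiv equiv _
    (fun t => (a * edgeInd X s(t.1, t.2.1) + b) * (a * edgeInd X s(t.2.1, t.2.2.1) + b) *
      (a * edgeInd X s(t.2.2.1, t.2.2.2) + b) * (a * edgeInd X s(t.2.2.2, t.1) + b))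
    fun _ => rfl).trans ?_
  simp only [Fintype.sum_prod_type, fourCycleSum]

lemma sum_prod_edge :
    ∑ φ : Fin 2 → Fin n, ∏ e ∈ ({s(0, 1)} : Finset (Sym2 (Fin 2))), edgeInd X (e.map φ) =
      2 * edgeCount X := by
  rw [← sum_edgeInd_eq]
  simp only [Finset.prod_singleton, Sym2.map_mk]
  exact (Fintype.sum_equiv (finTwoArrowEquiv (Fin n)) _ (fun t => edgeInd X s(t.1, t.2))
    fun _ => rfl).trans (Fintype.sum_prod_type _)

lemma copyCount_le_homDensity [NeZero n] {l : ℕ} (G : SimpleGraph (Fin l)) [Fintype G.edgeSet] :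
    (copyCount G X : ℝ) ≤ (n : ℝ) ^ l * homDensity G.edgeFinset X := by
  classical
  have hn : (n : ℝ) ^ l ≠ 0 := pow_ne_zero _ (Nat.cast_ne_zero.2 (NeZero.ne n))
  rw [copyCount_eq_sum, homDensity, Fintype.card_fin, mul_div_cancel₀ _ hn]
  refine (Finset.sum_le_sum fun φ hφ => ?_).trans
    (Finset.sum_le_univ_sum_of_nonneg fun φ => prod_edgeInd_nonneg _ _ φ)
  rw [prod_edgeInd_eq_edgesInd _ _ (Finset.mem_filter.1 hφ).2, imgEdges]
  refine le_of_eq ?_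
  congr! 2
  ext e
  simp

/-- The unordered pairs of different elements of `Fin l`. -/
def allPairs (l : ℕ) : Finset (Sym2 (Fin l)) := Finset.univ.filter fun e => ¬ e.IsDiag

open Classical in
/-- The indicator of `e` being mapped to an edge if it is an edge of `G`, and to a non-edge
otherwise. -/
def patternFactor {l : ℕ} (G : SimpleGraph (Fin l)) (e : Sym2 (Fin l)) (t : ℝ) : ℝ :=
  (if e ∈ G.edgeSet then 1 else -1) * t + if e ∈ G.edgeSet then 0 else 1

lemma patternFactor_nonneg {l : ℕ} (G : SimpleGraph (Fin l)) (e : Sym2 (Fin l)) {t : ℝ}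
    (h0 : 0 ≤ t) (h1 : t ≤ 1) : 0 ≤ patternFactor G e t := by
  unfold patternFactor
  split_ifs <;> linarith

lemma patternFactor_le_one {l : ℕ} (G : SimpleGraph (Fin l)) (e : Sym2 (Fin l)) {t : ℝ}
    (h0 : 0 ≤ t) (h1 : t ≤ 1) : patternFactor G e t ≤ 1 := by
  unfold patternFactor
  split_ifs <;> linarith

lemma prod_patternFactor {l : ℕ} (G : SimpleGraph (Fin l)) (p : ℝ) :
    ∏ e ∈ allPairs l, patternFactor G e p =
      p ^ edgeCount G * (1 - p) ^ (l.choose 2 - edgeCount G) := by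
  classical
  have h1 : ∀ e, patternFactor G e p = if e ∈ G.edgeSet then p else 1 - p := by
    intro e
    unfold patternFactor
    split_ifs <;> ring
  have h2 : ((allPairs l).filter fun e => e ∈ G.edgeSet) = G.edgeFinset := by
    ext e
    simp only [allPairs, Finset.mem_filter, Finset.mem_univ, true_and,
      SimpleGraph.mem_edgeFinset, and_iff_right_iff_imp]
    exact G.not_isDiag_of_mem_edgeSet
  have h3 : (allPairs l).card = l.choose 2 := by
    rw [allPairs, ← Fintype.card_subtype, Sym2.card_subtype_not_diag, Fintype.card_fin]
  have h4 := Finset.card_filter_add_card_filter_not (s := allPairs l) (fun e => e ∈ G.edgeSet)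
  rw [h2, h3, card_edgeFinset_eq_edgeCount] at h4
  simp only [h1]
  rw [Finset.prod_ite, Finset.prod_const, Finset.prod_const, h2, card_edgeFinset_eq_edgeCount]
  congr 2
  omega

open Classical in
lemma inducedCopyCount_eq_sum {l : ℕ} (G : SimpleGraph (Fin l)) :
    (inducedCopyCount G X : ℝ) = ∑ φ : Fin l → Fin n with Function.Injective φ,
      ∏ e ∈ allPairs l, patternFactor G e (edgeInd X (e.map φ)) := by
  have h1 : ∀ φ : Fin l → Fin n, Function.Injective φ →
      ∏ e ∈ allPairs l, patternFactor G e (edgeInd X (e.map φ)) =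
        if ∀ i j, X.Adj (φ i) (φ j) ↔ G.Adj i j then 1 else 0 := by
    intro φ hφ
    split_ifs with h
    · refine Finset.prod_eq_one fun e _ => ?_
      induction e using Sym2.ind with
      | _ i j =>
      rw [Sym2.map_mk, patternFactor, edgeInd_mk_eq_adjMatrix, SimpleGraph.adjMatrix_apply]
      by_cases hij : G.Adj i j
      · simp [hij, (h i j).2 hij]
      · simp [hij, mt (h i j).1 hij]
    · push Not at h
      obtain ⟨i, j, hij⟩ := h
      have hne : i ≠ j := by
        rintro rfl
        simp at hij
      refine Finset.prod_eq_zero (i := s(i, j)) (by simp [allPairs, hne]) ?_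
      rw [Sym2.map_mk, patternFactor, edgeInd_mk_eq_adjMatrix, SimpleGraph.adjMatrix_apply]
      rcases hij with ⟨h1, h2⟩ | ⟨h1, h2⟩
      · simp [h1, h2]
      · simp [h1, h2]
  have equiv : (G ↪g X) ≃ {φ : Fin l → Fin n // Function.Injective φ ∧
      ∀ i j, X.Adj (φ i) (φ j) ↔ G.Adj i j} :=
    { toFun := fun f => ⟨f, f.injective, fun _ _ => f.map_rel_iff⟩
      invFun := fun φ => ⟨⟨φ.1, φ.2.1⟩, fun {i j} => φ.2.2 i j⟩
      left_inv := fun _ => rfl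
      right_inv := fun _ => rfl }
  rw [Finset.sum_congr rfl fun φ hφ => h1 φ (Finset.mem_filter.1 hφ).2, Finset.sum_boole,
    Finset.filter_filter, inducedCopyCount, Nat.card_congr equiv, Nat.card_eq_fintype_card,
    Fintype.card_subtype]

end Counts

/-! ### Pseudo-randomness properties of typical sequences -/

section Typical

variable {p : ℝ} {X : (n : ℕ) → SimpleGraph (Fin n)}

lemma isLittleO_pow_of_tendsto_div {u : ℕ → ℝ} {l : ℕ}
    (h : Tendsto (fun n : ℕ => u n / (n : ℝ) ^ l) atTop (nhds 0)) :
    u =o[atTop] fun n : ℕ => (n : ℝ) ^ l := by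
  refine (isLittleO_iff_tendsto' ?_).2 h
  filter_upwards [eventually_gt_atTop 0] with n hn h0
  exact absurd h0 (by positivity)

lemma Typical.tendsto_inducedCopyCount (h : Typical p X) {l : ℕ} (G : SimpleGraph (Fin l)) :
    Tendsto (fun n : ℕ => (inducedCopyCount G (X n) : ℝ) / (n : ℝ) ^ l) atTop
      (nhds (p ^ edgeCount G * (1 - p) ^ (l.choose 2 - edgeCount G))) := by
  classical
  have h1 := h.tendsto_sum_prod (allPairs l) (fun e he => (Finset.mem_filter.1 he).2)
    (fun e => if e ∈ G.edgeSet then 1 else -1) (fun e => if e ∈ G.edgeSet then 0 else 1)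
  have h2 : ∏ e ∈ allPairs l, ((if e ∈ G.edgeSet then (1 : ℝ) else -1) * p +
      if e ∈ G.edgeSet then 0 else 1) = p ^ edgeCount G * (1 - p) ^ (l.choose 2 - edgeCount G) :=
    prod_patternFactor G p
  rw [h2] at h1
  have h3 : Tendsto (fun n : ℕ => (∑ φ : Fin l → Fin n with ¬ Function.Injective φ,
      ∏ e ∈ allPairs l, patternFactor G e (edgeInd (X n) (e.map φ))) / (n : ℝ) ^ l) atTop
      (nhds 0) := by
    have h4 := tendsto_card_not_injective (Fin l)
    simp only [Fintype.card_fin] at h4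
    have h0 : ∀ (n : ℕ) (φ : Fin l → Fin n),
        0 ≤ ∏ e ∈ allPairs l, patternFactor G e (edgeInd (X n) (e.map φ)) := fun n φ =>
      Finset.prod_nonneg fun e _ => patternFactor_nonneg G e (edgeInd_nonneg _ _)
        (edgeInd_le_one _ _)
    refine squeeze_zero (fun n => div_nonneg (Finset.sum_nonneg fun φ _ => h0 n φ)
      (by positivity)) (fun n => ?_) h4
    refine div_le_div_of_nonneg_right ?_ (by positivity)
    refine (Finset.sum_le_card_nsmul _ _ 1 fun φ _ => ?_).trans_eq (by simp)
    exact Finset.prod_le_one (fun e _ => patternFactor_nonneg G e (edgeInd_nonneg _ _)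
        (edgeInd_le_one _ _)) fun e _ => patternFactor_le_one G e (edgeInd_nonneg _ _)
        (edgeInd_le_one _ _)
  have h5 := h1.sub h3
  rw [sub_zero] at h5
  refine h5.congr fun n => ?_
  rw [← sub_div, inducedCopyCount_eq_sum]
  congr 1
  rw [sub_eq_iff_eq_add]
  exact (Finset.sum_filter_add_sum_filter_not _ _ _).symm

lemma Typical.tendsto_edgeCount (h : Typical p X) :
    Tendsto (fun n : ℕ => (2 * edgeCount (X n) : ℝ) / (n : ℝ) ^ 2) atTop (nhds p) := by
  have h1 := h 2 {s(0, 1)} (by simp)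
  simpa only [homDensity, sum_prod_edge, Fintype.card_fin, Finset.card_singleton, pow_one] using h1

lemma not_isDiag_of_mem_fourCycle : ∀ e ∈ fourCycle, ¬ e.IsDiag := by decide

lemma Typical.tendsto_fourCycleSum (h : Typical p X) (a b : ℝ) :
    Tendsto (fun n : ℕ => fourCycleSum (fun x y => a * edgeInd (X n) s(x, y) + b) / (n : ℝ) ^ 4)
      atTop (nhds ((a * p + b) ^ 4)) := by
  have h1 := h.tendsto_sum_prod fourCycle not_isDiag_of_mem_fourCycle (fun _ => a) (fun _ => b)
  simp only [sum_prod_fourCycle, Finset.prod_const] at h1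
  exact h1

lemma edgeCount_cycleGraph (l : ℕ) : edgeCount (SimpleGraph.cycleGraph (l + 3)) = l + 3 := by
  classical
  have h := (SimpleGraph.cycleGraph (l + 3)).sum_degrees_eq_twice_card_edges
  rw [card_edgeFinset_eq_edgeCount] at h
  have h2 : ∀ v, (SimpleGraph.cycleGraph (l + 3)).degree v = 2 := fun v => by
    convert SimpleGraph.cycleGraph_degree_three_le (n := l) (v := v)
  simp only [h2, Finset.sum_const, Finset.card_univ, Fintype.card_fin, smul_eq_mul] at h
  omega

lemma Typical.cycle_counts (h : Typical p X) {l : ℕ} (hl : 4 ≤ l) :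
    ∃ r : ℕ → ℝ, r =o[atTop] (fun n : ℕ => (n : ℝ) ^ l) ∧
      ∀ n : ℕ, (copyCount (SimpleGraph.cycleGraph l) (X n) : ℝ) ≤ ((n : ℝ) * p) ^ l + r n := by
  classical
  set G := SimpleGraph.cycleGraph l with hG
  obtain ⟨k, rfl⟩ : ∃ k, l = k + 3 := ⟨l - 3, by omega⟩
  have h1 := h (k + 3) G.edgeFinset fun e he =>
    G.not_isDiag_of_mem_edgeSet (SimpleGraph.mem_edgeFinset.1 he)
  rw [card_edgeFinset_eq_edgeCount, show edgeCount G = k + 3 from edgeCount_cycleGraph k] at h1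
  refine ⟨fun n => (n : ℝ) ^ (k + 3) * (homDensity G.edgeFinset (X n) - p ^ (k + 3)),
    isLittleO_pow_of_tendsto_div ?_, fun n => ?_⟩
  · have h2 := h1.sub_const (p ^ (k + 3))
    rw [sub_self] at h2
    refine h2.congr' ?_
    filter_upwards [eventually_gt_atTop 0] with n hn
    have : (n : ℝ) ^ (k + 3) ≠ 0 := by positivity
    rw [mul_div_cancel_left₀ _ this]
  · rcases Nat.eq_zero_or_pos n with rfl | hn
    · have : IsEmpty (G.Copy (X 0)) := ⟨fun f => (f.toHom 0).elim0⟩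
      simp [copyCount_eq_natCard]
    · have : NeZero n := ⟨hn.ne'⟩
      have := copyCount_le_homDensity (X n) G
      rw [mul_pow]
      linarith

/-- The closed 4-walk sum of the edge indicator minus `p` is o(n⁴), because its limit density is (p
- p)⁴. By `sum_sum_pow_four_le` it controls all `U` at once. -/
lemma Typical.induced_edges (h : Typical p X) :
    ∃ r : ℕ → ℝ, r =o[atTop] (fun n : ℕ => (n : ℝ) ^ 2) ∧
      ∀ (n : ℕ) (U : Finset (Fin n)),
        |(edgeCount ((X n).induce (U : Set (Fin n))) : ℝ) - p / 2 * (U.card : ℝ) ^ 2| ≤ r n := by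
  set f : (n : ℕ) → Fin n → Fin n → ℝ := fun n x y => 1 * edgeInd (X n) s(x, y) + -p with hf
  have hsymm : ∀ n x y, f n x y = f n y x := fun n x y => by simp only [hf, Sym2.eq_swap]
  refine ⟨fun n => (n : ℝ) ^ 2 * √√(fourCycleSum (f n) / (n : ℝ) ^ 4),
    isLittleO_pow_of_tendsto_div ?_, fun n U => ?_⟩
  · have h1 := (h.tendsto_fourCycleSum 1 (-p)).sqrt.sqrt
    have h2 : √√((1 * p + -p) ^ 4) = 0 := by simp
    rw [h2] at h1
    refine h1.congr' ?_
    filter_upwards [eventually_gt_atTop 0] with n hn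
    have : (n : ℝ) ^ 2 ≠ 0 := by positivity
    rw [mul_div_cancel_left₀ _ this]
  · rcases Nat.eq_zero_or_pos n with rfl | hn
    · obtain rfl : U = ∅ := Finset.eq_empty_of_isEmpty U
      have h1 := sum_edgeInd_finset_eq (X 0) ∅
      rw [Finset.sum_empty, zero_eq_mul] at h1
      rw [h1.resolve_left two_ne_zero]
      simp
    set D : ℝ := ∑ x ∈ U, ∑ y ∈ U, f n x y with hD
    -- The diagonal pairs also contribute `-p` each, so the subtracted term is exactly `p * U.card ^
    -- 2`.
    have hDeq : (edgeCount ((X n).induce (U : Set (Fin n))) : ℝ) - p / 2 * (U.card : ℝ) ^ 2 =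
        D / 2 := by
      simp only [hD, hf, one_mul, Finset.sum_add_distrib, sum_edgeInd_finset_eq, Finset.sum_const,
        nsmul_eq_mul]
      ring
    have h4 : D ^ 4 ≤ (n : ℝ) ^ 4 * fourCycleSum (f n) := sum_sum_pow_four_le (hsymm n) U
    have h5 : |D| ≤ (n : ℝ) ^ 2 * √√(fourCycleSum (f n) / (n : ℝ) ^ 4) := by
      have hn' : (n : ℝ) ^ 4 ≠ 0 := by positivity
      have h6 : 0 ≤ fourCycleSum (f n) / (n : ℝ) ^ 4 :=
        div_nonneg (fourCycleSum_nonneg (hsymm n)) (by positivity)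
      refine le_of_pow_le_pow_left₀ (four_ne_zero) (by positivity) ?_
      rw [Even.pow_abs (by decide), mul_pow]
      have h7 : √√(fourCycleSum (f n) / (n : ℝ) ^ 4) ^ 4 = fourCycleSum (f n) / (n : ℝ) ^ 4 := by
        rw [show 4 = 2 * 2 from rfl, pow_mul, Real.sq_sqrt (Real.sqrt_nonneg _), Real.sq_sqrt h6]
      rw [h7]
      refine h4.trans_eq ?_
      field_simp
    rw [hDeq, abs_div, abs_two]
    linarith [abs_nonneg D]

lemma Typical.edges_isLittleO (h : Typical p X) :
    (fun n : ℕ => (edgeCount (X n) : ℝ) - (n : ℝ) ^ 2 * p / 2)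
      =o[atTop] fun n : ℕ => (n : ℝ) ^ 2 := by
  refine isLittleO_pow_of_tendsto_div ?_
  have h1 := (h.tendsto_edgeCount.sub_const p).div_const 2
  rw [sub_self, zero_div] at h1
  refine h1.congr' ?_
  filter_upwards [eventually_gt_atTop 0] with n hn
  have : (n : ℝ) ≠ 0 := by positivity
  field_simp

open Classical in
lemma Typical.eventually_eigenvalues (h : Typical p X) (hp : 0 < p) :
    ∀ᶠ n : ℕ in atTop, (2 * edgeCount (X n) : ℝ) / (n : ℝ) ^ 2 ≤ adjEigenvalue (X n) 0 / n ∧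
      (adjEigenvalue (X n) 0 / n) ^ 4 + (adjEigenvalue (X n) 1 / n) ^ 4 ≤
        fourCycleSum ((X n).adjMatrix ℝ) / (n : ℝ) ^ 4 := by
  have h1 := h.tendsto_edgeCount
  have h2 := h.tendsto_fourCycleSum 1 0
  simp only [one_mul, add_zero, edgeInd_mk_eq_adjMatrix] at h2
  have h3 := (h1.pow 4).const_mul 2
  have h4 : p ^ 4 < 2 * p ^ 4 := by linarith [pow_pos hp 4]
  filter_upwards [h2.eventually_lt h3 h4, h1.eventually (lt_mem_nhds hp), eventually_ge_atTop 2]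
    with n hn1 hn2 hn
  have hn0 : (0 : ℝ) < n := by positivity
  -- Here `m` is the average degree; the 4-walk hypothesis holds eventually because p⁴ < 2p⁴.
  have h5 := adjEigenvalue_bounds hn (X n) (m := 2 * edgeCount (X n) / n) ?_ ?_ ?_
  · refine ⟨?_, ?_⟩
    · rw [sq, ← div_div]
      exact div_le_div_of_nonneg_right h5.1 hn0.le
    · rw [div_pow, div_pow, ← add_div]
      exact div_le_div_of_nonneg_right h5.2 (by positivity)
  · have : 0 < (2 * edgeCount (X n) : ℝ) := by
      by_contra hcon
      exact absurd hn2 (not_lt.2 (div_nonpos_of_nonpos_of_nonneg (not_lt.1 hcon) (by positivity)))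
    positivity
  · rw [div_mul_cancel₀ _ hn0.ne', ← sum_edgeInd_eq]
    simp only [edgeInd_mk_eq_adjMatrix]
    exact le_rfl
  · rw [div_lt_iff₀ (by positivity)] at hn1
    refine hn1.trans_eq ?_
    field_simp

lemma le_sqrt_sqrt {x y : ℝ} (h : x ^ 4 ≤ y) : |x| ≤ √√y := by
  refine Real.le_sqrt_of_sq_le (Real.le_sqrt_of_sq_le ?_)
  rw [sq_abs, ← pow_mul]
  exact h

/-- The first eigenvalue over n is squeezed between the edge density and the fourth root of the
closed 4-walk density, both tending to `p`. It thus uses up the whole limit p⁴, leaving nothing for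
the second. -/
lemma Typical.eigenvalues (h : Typical p X) (hp : 0 < p) :
    Tendsto (fun n : ℕ => adjEigenvalue (X n) 0 / n) atTop (nhds p) ∧
      Tendsto (fun n : ℕ => adjEigenvalue (X n) 1 / n) atTop (nhds 0) := by
  classical
  have h1 := h.tendsto_edgeCount
  have h2 := h.tendsto_fourCycleSum 1 0
  simp only [one_mul, add_zero, edgeInd_mk_eq_adjMatrix] at h2
  have hev := h.eventually_eigenvalues hp
  have h3 : Tendsto (fun n : ℕ => adjEigenvalue (X n) 0 / n) atTop (nhds p) := by
    have h4 := h2.sqrt.sqrt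
    have h5 : √√(p ^ 4) = p := by
      rw [show p ^ 4 = (p ^ 2) ^ 2 by ring, Real.sqrt_sq (sq_nonneg p), Real.sqrt_sq hp.le]
    rw [h5] at h4
    refine tendsto_of_tendsto_of_tendsto_of_le_of_le' h1 h4 (hev.mono fun n hn => hn.1)
      (hev.mono fun n hn => (le_abs_self _).trans (le_sqrt_sqrt ?_))
    have : 0 ≤ (adjEigenvalue (X n) 1 / n) ^ 4 := Even.pow_nonneg (by decide) _
    linarith [hn.2]
  refine ⟨h3, ?_⟩
  have h4 := (h2.sub (h3.pow 4)).sqrt.sqrt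
  rw [sub_self, Real.sqrt_zero, Real.sqrt_zero] at h4
  refine squeeze_zero_norm' (hev.mono fun n hn => ?_) h4
  rw [Real.norm_eq_abs]
  exact le_sqrt_sqrt (by linarith [hn.2])

lemma Typical.weaklyPseudoRandom (h : Typical p X) (hp0 : 0 < p) (hp1 : p < 1) :
    WeaklyPseudoRandom p X where
  induced_counts l _ G := by
    have hq : 0 < 1 - p := by linarith
    set c := p ^ edgeCount G * (1 - p) ^ (l.choose 2 - edgeCount G) with hc
    have hcpos : 0 < c := by positivity
    have h1 := (h.tendsto_inducedCopyCount G).div_const c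
    rw [← hc, div_self hcpos.ne'] at h1
    refine (isEquivalent_iff_tendsto_one ?_).2 (h1.congr fun n => ?_)
    · filter_upwards [eventually_gt_atTop 0] with n hn
      positivity
    · rw [Pi.div_apply, mul_assoc, ← hc, div_div]
  edges_ge := ⟨_, h.edges_isLittleO, fun n => by linarith⟩
  first_eigenvalue := by
    have h1 := (h.eigenvalues hp0).1.div_const p
    rw [div_self hp0.ne'] at h1
    refine (isEquivalent_iff_tendsto_one ?_).2 (h1.congr fun n => ?_)
    · filter_upwards [eventually_gt_atTop 0] with n hn
      positivity
    · rw [Pi.div_apply, div_div]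
  second_eigenvalue := by
    have h1 := isLittleO_pow_of_tendsto_div (u := fun n => adjEigenvalue (X n) 1) (l := 1)
      (by simpa only [pow_one] using (h.eigenvalues hp0).2)
    simpa only [pow_one] using h1
  induced_edges := h.induced_edges
  edges_eq := h.edges_isLittleO
  cycle_counts _ hl _ := h.cycle_counts hl

end Typical

end ERG

end

/-- In the high temperature phase there are events `S n` of probability `1 - o(1)` such that every
graph sequence that lies in the events `S n` from some point on is weakly pseudo-random with
density `p*`. -/
theorem mainTheorem4 (M : ERG.Model) (p : ℝ) (hp : M.HighTemperature p) :
    ∃ S : (n : ℕ) → Set (SimpleGraph (Fin n)),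
      Filter.Tendsto (fun n : ℕ => M.prob (S n)) Filter.atTop (nhds 1) ∧
      ∀ X : (n : ℕ) → SimpleGraph (Fin n),
        (∀ᶠ n in Filter.atTop, X n ∈ S n) → ERG.WeaklyPseudoRandom p X := by
  obtain ⟨S, hS, hX⟩ := hp.exists_typical
  exact ⟨S, hS, fun X h => ERG.Typical.weaklyPseudoRandom (hX X h) hp.pos hp.lt_one⟩
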